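/- **Setting.** Let $O=(DY,D,Z)$, where $D\in\{0,1\}$, the real outcome $Y$ is observed if and only if $D=1$, and $Z$ takes values in a measurable space. Let $\delta\ne 0$. For a law $P$ of $O$ put $$a_P(Z)=\frac{E_P\{DYe^{\delta Y}\mid Z\}}{E_P\{De^{\delta Y}\mid Z\}},\qquad b_P(Z)=\frac{E_P(1-D\mid Z)}{E_P\{De^{\delta Y}\mid Z\}},\qquad S_{ab}=-De^{\delta Y},$$ $$\psi(P)=E_P\{(1-D)a_P(Z)\},\qquad \chi(P)=E_P\{DY+(1-D)a_P(Z)\}$$ ($\chi(P)$ is the mean of $Y$ if $p(y\mid D=0,Z)=p(y\mid D=1,Z)e^{\delta y}/E(e^{\delta Y}\mid D=1,Z)$). Let $\mathcal M$ be a non-parametric model for the law of $O$: a set of probability laws with the same null sets such that, with $P$, every probability law whose density with respect to $P$ is bounded and bounded away from $0$ is in $\mathcal M$. Suppose that for all $P,P',P''\in\mathcal M$: $De^{\delta Y}$ and $DYe^{\delta Y}$ are $P$-integrable, $E_P\{De^{\delta Y}\mid Z\}>0$ a.s., $a_P(Z)\in L_2(P)$, $b_P(Z)De^{\delta Y}\{Y-a_P(Z)\}\in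 L_2(P)$, and $S_{ab}\,a_{P'}(Z)b_{P''}(Z)$ and $DYe^{\delta Y}b_{P'}(Z)$ are $P$-integrable. Suppose also that, under some $P\in\mathcal M$, $Y$ is not a.s. a function of $Z$ on the event $\{D=1,\ P(D=0\mid Z)>0\}$. **Definitions.** An *influence function* of a parameter $\theta:\mathcal M\to\mathbb R$ at $P$ is a mean-zero $\theta^1_P\in L_2(P)$ with $\frac{d}{dt}\theta(P_t)|_{t=0}=E_P(\theta^1_P\,g)$ for every submodel $t\mapsto P_t\in\mathcal M$, $P_0=P$, whose likelihood ratios $r_t=dP_t/dP$ are, for $t$ near $0$, bounded and bounded away from $0$ uniformly in $t$, and satisfy $(r_t-1)/t\to g$ in $L_2(P)$. Let $Z^*$ be a function of $O$. The parameter $\theta$ has the *mixed bias property* for the covariate $Z^*$, with $S(O)$, $\alpha_P(Z^*)$, $\beta_P(Z^*)$, where $S$ does not depend on $P$, if it has influence functions $\theta^1_P$ such that for all $P,P'\in\mathcal M$ the following expectations exist and $$\theta(P')-\theta(P)+E_P(\theta^1_{P'})=E_P\big[S\{\alpha_{P'}(Z^*)-\alpha_P(Z^*)\}\{\beta_{P'}(Z^*)-\beta_P(Z^*)\}\big].$$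 It is in the *Chernozhukov–Newey class* for $Z^*$ if there are integrable statistics $q(O)$, $S_0^*(O)$ and a map $m_1^*(O,h)$, none depending on $P$, such that for all $P\in\mathcal M$: $a^*_P(Z^*)=E_P\{q(O)\mid Z^*\}$ is in $L_2(P_{Z^*})$, the map $h\in L_2(P_{Z^*})\mapsto E_P\{m_1^*(O,h)\}$ is well defined, linear and continuous, and $$\theta(P)=E_P\{m_1^*(O,a_P^*)\}+E_P(S_0^*).$$ It is a *regular* member of this class if it has an influence function at each $P\in\mathcal M$ and, for some such representation, with $\mathcal R_P(Z^*)$ the Riesz representer of $h\mapsto E_P\{m_1^*(O,h)\}$, one has $a^*_{P'},\mathcal R_{P'}\in L_2(P_{Z^*})$ for all $P,P'\in\mathcal M$. **Claim.** 1. $\psi$ has the mixed bias property for the covariate $Z$, with $S_{ab}$, $a_P$ and $b_P$ as above. 2. $\psi$ is not in the Chernozhukov–Newey class for $Z^*=Z$, nor in the one for $Z^*=(D,Z)$. 3. If $DY\in L_2(P)$ for all $P\in\mathcal M$, then 1 and 2 also hold with $\chi$ in place of $\psi$. 4. Hence the class of parameters with the mixed bias property for the covariate $Z$ or $(D,Z)$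 strictly contains the class of regular members of the Chernozhukov–Newey class for $Z$ or $(D,Z)$. -/

import Mathlib

open MeasureTheory Filter Topology

noncomputable section

namespace MixedBias

universe u v

section General

variable {Ω : Type u} [MeasurableSpace Ω] {W : Type v} [MeasurableSpace W]

/-- A conditional expectation given a covariate `cov` is a measurable function of `cov`. -/
theorem exists_condMean (P : Measure Ω) (cov : Ω → W) (f : Ω → ℝ) :
    ∃ r : W → ℝ, Measurable r ∧ P[f | MeasurableSpace.comap cov inferInstance] = r ∘ cov :=
  Measurable.exists_eq_measurable_comp stronglyMeasurable_condExp.measurable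

/-- `condMean P cov f w` is (a version of) `E_P {f(O) | cov(O) = w}`. -/
def condMean (P : Measure Ω) (cov : Ω → W) (f : Ω → ℝ) : W → ℝ :=
  (exists_condMean P cov f).choose

theorem measurable_condMean (P : Measure Ω) (cov : Ω → W) (f : Ω → ℝ) :
    Measurable (condMean P cov f) :=
  (exists_condMean P cov f).choose_spec.1

theorem condMean_comp (P : Measure Ω) (cov : Ω → W) (f : Ω → ℝ) :
    condMean P cov f ∘ cov = P[f | MeasurableSpace.comap cov inferInstance] :=
  (exists_condMean P cov f).choose_spec.2.symm

/-- A non-parametric model: a family of probability laws with the same null sets, which is locally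
unrestricted, i.e. with a law `P` it contains every probability law whose density with respect to
`P` is bounded and bounded away from zero. -/
structure IsNonparametric (M : Set (Measure Ω)) : Prop where
  prob : ∀ P ∈ M, IsProbabilityMeasure P
  ac : ∀ P ∈ M, ∀ P' ∈ M, P ≪ P'
  closed : ∀ P ∈ M, ∀ (f : Ω → ℝ) (c C : ℝ), Measurable f → 0 < c → (∀ o, c ≤ f o ∧ f o ≤ C) →
    ∫ o, f o ∂P = 1 → P.withDensity (fun o => ENNReal.ofReal (f o)) ∈ M

/-- `γ` is a regular parametric submodel of `M` through `P` (at parameter value `0`) with score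
`g`: the likelihood ratios `r t = dP_t / dP` are uniformly bounded and bounded away from zero
near `t = 0`, and are differentiable in quadratic mean at `0` with derivative `g`. -/
structure IsRegularSubmodel (M : Set (Measure Ω)) (P : Measure Ω) (γ : ℝ → Measure Ω)
    (g : Ω → ℝ) : Prop where
  zero : γ 0 = P
  mem : ∀ᶠ t in 𝓝 (0 : ℝ), γ t ∈ M
  score : MemLp g 2 P
  ratio : ∃ (r : ℝ → Ω → ℝ) (c C : ℝ), 0 < c ∧ (∀ t, Measurable (r t)) ∧
    (∀ᶠ t in 𝓝 (0 : ℝ), (∀ o, c ≤ r t o ∧ r t o ≤ C) ∧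
      γ t = P.withDensity (fun o => ENNReal.ofReal (r t o))) ∧
    Tendsto (fun t => eLpNorm (fun o => (r t o - 1) / t - g o) 2 P) (𝓝[≠] 0) (𝓝 0)

/-- `φ` is an influence function at `P` of the parameter `χ` on the model `M`. -/
structure IsInfluenceFunction (M : Set (Measure Ω)) (χ : Measure Ω → ℝ) (P : Measure Ω)
    (φ : Ω → ℝ) : Prop where
  memLp : MemLp φ 2 P
  mean_zero : ∫ o, φ o ∂P = 0
  deriv : ∀ (γ : ℝ → Measure Ω) (g : Ω → ℝ), IsRegularSubmodel M P γ g →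
    HasDerivAt (fun t => χ (γ t)) (∫ o, φ o * g o ∂P) 0

/-- The mixed bias property of `χ` on the model `M`, for the covariate `cov`, the known function
`s = s_ab` and the nuisance functions `a P`, `b P` of the covariate. -/
def MixedBiasWith (M : Set (Measure Ω)) (cov : Ω → W) (χ : Measure Ω → ℝ) (s : Ω → ℝ)
    (a b : Measure Ω → W → ℝ) : Prop :=
  Measurable s ∧ (∀ P ∈ M, Measurable (a P) ∧ Measurable (b P)) ∧
  ∃ χ1 : Measure Ω → Ω → ℝ, (∀ P ∈ M, IsInfluenceFunction M χ P (χ1 P)) ∧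
    ∀ P ∈ M, ∀ P' ∈ M,
      Integrable (χ1 P') P ∧
      Integrable
        (fun o => s o * (a P' (cov o) - a P (cov o)) * (b P' (cov o) - b P (cov o))) P ∧
      χ P' - χ P + ∫ o, χ1 P' o ∂P =
        ∫ o, s o * (a P' (cov o) - a P (cov o)) * (b P' (cov o) - b P (cov o)) ∂P

/-- The class of parameters on `M` with the mixed bias property for the covariate `cov`. -/
def mixedBiasClass (M : Set (Measure Ω)) (cov : Ω → W) : Set (Measure Ω → ℝ) :=
  {χ | ∃ (s : Ω → ℝ) (a b : Measure Ω → W → ℝ), MixedBiasWith M cov χ s a b}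

/-- `χ(P) = E_P {m(O, a_P)} + E_P S₀` for all `P ∈ M`, where `a_P = E_P {q(O) | cov(O)}` is in
`L₂(P_cov)`, `q` and `S₀` are statistics, and `h ∈ L₂(P_cov) ↦ E_P {m(O, h)}` is well defined,
linear and continuous for each `P ∈ M`; neither `m`, `q` nor `S₀` depends on `P`. -/
structure IsCNRepresentation (M : Set (Measure Ω)) (cov : Ω → W) (χ : Measure Ω → ℝ)
    (m : Ω → (W → ℝ) → ℝ) (q S₀ : Ω → ℝ) : Prop where
  measurable_q : Measurable q
  measurable_S₀ : Measurable S₀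
  integrable_q : ∀ P ∈ M, Integrable q P
  integrable_S₀ : ∀ P ∈ M, Integrable S₀ P
  memLp_a : ∀ P ∈ M, MemLp (condMean P cov q) 2 (P.map cov)
  integrable_m : ∀ P ∈ M, ∀ h : W → ℝ, Measurable h → MemLp h 2 (P.map cov) →
    Integrable (fun o => m o h) P
  continuous_linear : ∀ P ∈ M, ∃ L : Lp ℝ 2 (P.map cov) →L[ℝ] ℝ,
    ∀ (h : W → ℝ) (_ : Measurable h) (hh : MemLp h 2 (P.map cov)),
      ∫ o, m o h ∂P = L (hh.toLp h)
  eq : ∀ P ∈ M, χ P = ∫ o, m o (condMean P cov q) ∂P + ∫ o, S₀ o ∂P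

/-- The Chernozhukov–Newey class of parameters on `M`, for the covariate `cov`. -/
def cnClass (M : Set (Measure Ω)) (cov : Ω → W) : Set (Measure Ω → ℝ) :=
  {χ | ∃ (m : Ω → (W → ℝ) → ℝ) (q S₀ : Ω → ℝ), IsCNRepresentation M cov χ m q S₀}

/-- `R P` is the Riesz representer of `h ∈ L₂(P_cov) ↦ E_P {m(O, h)}`, for each `P ∈ M`. -/
def IsRieszFamily (M : Set (Measure Ω)) (cov : Ω → W) (m : Ω → (W → ℝ) → ℝ)
    (R : Measure Ω → W → ℝ) : Prop :=
  ∀ P ∈ M, Measurable (R P) ∧ MemLp (R P) 2 (P.map cov) ∧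
    ∀ h : W → ℝ, Measurable h → MemLp h 2 (P.map cov) →
      ∫ o, m o h ∂P = ∫ w, R P w * h w ∂(P.map cov)

/-- The regular parameters of the Chernozhukov–Newey class: `χ` has an influence function at each
law of the model, and the conditional mean `a_P'` and the Riesz representer `R_P'` are
square integrable under every law `P` of the model, so that the two sides of the mixed bias
identity are well defined. -/
def regularCNClass (M : Set (Measure Ω)) (cov : Ω → W) : Set (Measure Ω → ℝ) :=
  {χ | (∀ P ∈ M, ∃ φ : Ω → ℝ, IsInfluenceFunction M χ P φ) ∧
    ∃ (m : Ω → (W → ℝ) → ℝ) (q S₀ : Ω → ℝ) (R : Measure Ω → W → ℝ),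
      IsCNRepresentation M cov χ m q S₀ ∧ IsRieszFamily M cov m R ∧
      ∀ P ∈ M, ∀ P' ∈ M,
        MemLp (condMean P' cov q) 2 (P.map cov) ∧ MemLp (R P') 2 (P.map cov)}

end General

section MNAR

/-- The observed data `O = (DY, D, Z)`. -/
abbrev Obs (𝒵 : Type u) : Type u := ℝ × Bool × 𝒵

variable {𝒵 : Type u}

/-- The covariate `Z`. -/
def covZ (o : Obs 𝒵) : 𝒵 := o.2.2

/-- The covariate `(D, Z)`. -/
def covDZ (o : Obs 𝒵) : Bool × 𝒵 := o.2

/-- The observed outcome `DY`. -/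
def obsY (o : Obs 𝒵) : ℝ := o.1

/-- The indicator `D`, as a real number. -/
def obsD (o : Obs 𝒵) : ℝ := if o.2.1 then 1 else 0

/-- `D exp(δ Y)`. -/
def tiltW (δ : ℝ) (o : Obs 𝒵) : ℝ := obsD o * Real.exp (δ * obsY o)

/-- `D Y exp(δ Y)`. -/
def tiltYW (δ : ℝ) (o : Obs 𝒵) : ℝ := obsY o * tiltW δ o

variable [MeasurableSpace 𝒵]

/-- `a(Z) = E {D Y exp(δ Y) | Z} / E {D exp(δ Y) | Z}`. -/
def tiltA (δ : ℝ) (P : Measure (Obs 𝒵)) (z : 𝒵) : ℝ :=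
  condMean P covZ (tiltYW δ) z / condMean P covZ (tiltW δ) z

/-- `b(Z) = E (1 - D | Z) / E {D exp(δ Y) | Z}`. -/
def tiltB (δ : ℝ) (P : Measure (Obs 𝒵)) (z : 𝒵) : ℝ :=
  condMean P covZ (fun o => 1 - obsD o) z / condMean P covZ (tiltW δ) z

/-- `ψ(P) = E {(1 - D) a(Z)}`. -/
def psi (δ : ℝ) (P : Measure (Obs 𝒵)) : ℝ :=
  ∫ o, (1 - obsD o) * tiltA δ P (covZ o) ∂P

/-- `E {D Y + (1 - D) a(Z)}`, the mean of `Y` under the exponential tilt assumption. -/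
def meanMNAR (δ : ℝ) (P : Measure (Obs 𝒵)) : ℝ :=
  ∫ o, (obsY o + (1 - obsD o) * tiltA δ P (covZ o)) ∂P

/-- Existence and moment conditions on a model for `O = (DY, D, Z)`. -/
structure MNARConditions (δ : ℝ) (M : Set (Measure (Obs 𝒵))) : Prop where
  /-- `Y` is observed only if `D = 1`: the coordinate `DY` vanishes if `D = 0`. -/
  missing : ∀ P ∈ M, ∀ᵐ o ∂P, o.2.1 = false → obsY o = 0
  integrable_W : ∀ P ∈ M, Integrable (tiltW δ) P
  integrable_YW : ∀ P ∈ M, Integrable (tiltYW δ) P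
  pos : ∀ P ∈ M, ∀ᵐ o ∂P, 0 < condMean P covZ (tiltW δ) (covZ o)
  memLp_a : ∀ P ∈ M, MemLp (tiltA δ P) 2 (P.map covZ)
  /-- Finite variance of `b(Z) D exp(δ Y) {Y - a(Z)}`. -/
  memLp_residual : ∀ P ∈ M,
    MemLp (fun o => tiltB δ P (covZ o) * (tiltW δ o * (obsY o - tiltA δ P (covZ o)))) 2 P
  /-- `S_ab a'(Z) b''(Z)` is integrable for all `a'` and `b''` attained on the model. -/
  integrable_ab : ∀ P ∈ M, ∀ P' ∈ M, ∀ P'' ∈ M,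
    Integrable (fun o => tiltW δ o * tiltA δ P' (covZ o) * tiltB δ P'' (covZ o)) P
  /-- `q(O) b'(Z)` is integrable for all `b'` attained on the model. -/
  integrable_qb : ∀ P ∈ M, ∀ P' ∈ M, Integrable (fun o => tiltYW δ o * tiltB δ P' (covZ o)) P

/-- Under some law of the model, `Y` is not almost surely a function of `Z` on the event that
`D = 1` and `pr(D = 0 | Z) > 0`. -/
def OutcomeNondegenerate (M : Set (Measure (Obs 𝒵))) : Prop :=
  ∃ P ∈ M, ∀ f : 𝒵 → ℝ, Measurable f →
    P {o | o.2.1 = true ∧ 0 < condMean P covZ (fun o => 1 - obsD o) (covZ o) ∧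
      obsY o ≠ f (covZ o)} ≠ 0

end MNAR

end MixedBias

end

/-! Write W = D exp(δY). Then E(1 - D | Z) = b E(W | Z) and E(YW | Z) = a E(W | Z). Mixed bias of ψ:
these two relations turn every term of ψ(P') - ψ(P) + E_P(ψ¹_{P'}), with ψ¹ = (1 - D)a + bW(Y - a) -
ψ, into an integral of W times a product of nuisance functions, and the sum is -E_P{W(a' - a)(b' -
b)} (`psi_mixedBias`). The same identity with the two laws exchanged gives an exact formula for the
increment (`psi_sub`): ψ(Q) - ψ(P) = ∫ (r - 1){ψ¹_P + (b_Q - b_P)W(Y - a_P)} dP for dQ = r dP. After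
division by t, only the L₂ convergence of the remainder is needed (`tendsto_eLpNorm_remainder`), so
ψ¹ is an influence function.

Non-membership: let dP_t = (1 + tw) dP with E_P(w | D, Z) = 0. The law of (D, Z), hence of Z, does
not move, so E_{P_t}(q | Z*) is affine in t for either covariate, and a Chernozhukov–Newey parameter
is a polynomial of degree at most two in t (`third_difference_eq_zero`). But ψ(P_t) = E_P{(1 -
D)a_t(Z)} with a_t a fractional linear function of t. With C = E(W | Z), C₁ = E(wW | Z) and β =
E(wYW | Z) - aC₁, the third difference of a_t at 2, 1, 0, -1 is 6βC₁²/{(C + 2C₁)(C + C₁)(C - C₁)},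
where |C₁| ≤ C/4 keeps the denominator positive. If β ≥ 0, a vanishing third difference of ψ forces
βC₁ = 0 wherever pr(D = 0 | Z) > 0 (`moment_eq_zero_of_third_difference`). The score is w = (v - E(v
| D, Z))/4 with v the indicator of {D = 1, Y > a(Z)} (`exists_score`). Then β = E{v(Y - a)W | Z}/4 ≥
0, and δC₁ ≥ 0 because exp(δY) is monotone in Y. If either moment vanishes at Z, the residual (Y -
a)W has one sign there; as its conditional mean is zero, Y = a(Z) when D = 1, which nondegeneracy
excludes. The parameter χ differs from ψ by the mean of DY, which affects neither property.

Inclusion of the regular class: the influence function is determined almost everywhere by the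
derivatives along bounded linear submodels (`influence_ae_eq`), hence equals m(O, a*) + R(q - a*) +
S₀ - θ. The Riesz identity then gives the mixed bias property with S = -1 and nuisance functions a*
and R. The inclusion is strict because of ψ. -/

namespace MixedBias

universe u v

/-! ### Conditional means as functions of the covariate. -/

section Conditional

theorem stronglyMeasurable_comp_cov {Ω : Type u} {W : Type v} [MeasurableSpace W]
    {cov : Ω → W} {h : W → ℝ} (hh : Measurable h) :
    StronglyMeasurable[MeasurableSpace.comap cov inferInstance] (fun o => h (cov o)) :=
  (hh.comp (comap_measurable cov)).stronglyMeasurable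

variable {Ω : Type u} [MeasurableSpace Ω] {W : Type v} [MeasurableSpace W]
  {P : Measure Ω} {cov : Ω → W} {f g : Ω → ℝ} {h : W → ℝ}

theorem condMean_apply (P : Measure Ω) (cov : Ω → W) (f : Ω → ℝ) (o : Ω) :
    condMean P cov f (cov o) = (P[f | MeasurableSpace.comap cov inferInstance]) o :=
  congrFun (condMean_comp P cov f) o

theorem integrable_condMean : Integrable (fun o => condMean P cov f (cov o)) P := by
  simp only [condMean_apply]
  exact integrable_condExp

theorem condMean_congr (hfg : f =ᵐ[P] g) :
    ∀ᵐ o ∂P, condMean P cov f (cov o) = condMean P cov g (cov o) := by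
  simp only [condMean_apply]
  exact condExp_congr_ae hfg

theorem condMean_add (hf : Integrable f P) (hg : Integrable g P) :
    ∀ᵐ o ∂P, condMean P cov (fun o => f o + g o) (cov o)
      = condMean P cov f (cov o) + condMean P cov g (cov o) := by
  simp only [condMean_apply]
  exact condExp_add hf hg _

theorem condMean_sub (hf : Integrable f P) (hg : Integrable g P) :
    ∀ᵐ o ∂P, condMean P cov (fun o => f o - g o) (cov o)
      = condMean P cov f (cov o) - condMean P cov g (cov o) := by
  simp only [condMean_apply]
  exact condExp_sub hf hg _

theorem condMean_const_mul (c : ℝ) (f : Ω → ℝ) :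
    ∀ᵐ o ∂P, condMean P cov (fun o => c * f o) (cov o) = c * condMean P cov f (cov o) := by
  simp only [condMean_apply]
  exact condExp_smul c f _

theorem condMean_nonneg (hf : ∀ᵐ o ∂P, 0 ≤ f o) :
    ∀ᵐ o ∂P, 0 ≤ condMean P cov f (cov o) := by
  simp only [condMean_apply]
  exact condExp_nonneg hf

theorem condMean_mono (hf : Integrable f P) (hg : Integrable g P) (hfg : ∀ᵐ o ∂P, f o ≤ g o) :
    ∀ᵐ o ∂P, condMean P cov f (cov o) ≤ condMean P cov g (cov o) := by
  simp only [condMean_apply]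
  exact condExp_mono hf hg hfg

theorem abs_condMean_le (hf : Integrable f P) (hg : Integrable g P)
    (hfg : ∀ᵐ o ∂P, |f o| ≤ g o) :
    ∀ᵐ o ∂P, |condMean P cov f (cov o)| ≤ condMean P cov g (cov o) := by
  have h1 := condMean_mono (cov := cov) hf hg (hfg.mono fun o ho => (abs_le.1 ho).2)
  have h2 := condMean_mono (cov := cov) (hf.const_mul (-1)) hg
    (hfg.mono fun o ho => by linarith [(abs_le.1 ho).1])
  filter_upwards [h1, h2, condMean_const_mul (P := P) (cov := cov) (-1) f] with o h1 h2 h3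
  exact abs_le.2 ⟨by linarith, h1⟩

/-- Conditioning pulls out functions of the covariate. -/
theorem condMean_mul (hh : Measurable h) (hf : Integrable f P)
    (hhf : Integrable (fun o => h (cov o) * f o) P) :
    ∀ᵐ o ∂P, condMean P cov (fun o => h (cov o) * f o) (cov o)
      = h (cov o) * condMean P cov f (cov o) := by
  simp only [condMean_apply]
  exact condExp_mul_of_stronglyMeasurable_left (stronglyMeasurable_comp_cov hh) hhf hf

theorem integrable_mul_condMean (hh : Measurable h) (hf : Integrable f P)
    (hhf : Integrable (fun o => h (cov o) * f o) P) :
    Integrable (fun o => h (cov o) * condMean P cov f (cov o)) P :=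
  integrable_condMean.congr (condMean_mul hh hf hhf)

variable [IsFiniteMeasure P]

theorem condMean_const (hcov : Measurable cov) (c : ℝ) (o : Ω) :
    condMean P cov (fun _ => c) (cov o) = c := by
  rw [condMean_apply, condExp_const hcov.comap_le]

theorem integral_condMean (hcov : Measurable cov) :
    ∫ o, condMean P cov f (cov o) ∂P = ∫ o, f o ∂P := by
  simp only [condMean_apply]
  exact integral_condExp hcov.comap_le

theorem integral_mul_condMean (hcov : Measurable cov) (hh : Measurable h) (hf : Integrable f P)
    (hhf : Integrable (fun o => h (cov o) * f o) P) :
    ∫ o, h (cov o) * f o ∂P = ∫ o, h (cov o) * condMean P cov f (cov o) ∂P := by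
  rw [← integral_condMean hcov]
  exact integral_congr_ae (condMean_mul hh hf hhf)

/-- For a nonnegative statistic, integrability against a function of the covariate can be read off
from its conditional mean. -/
theorem integrable_mul_of_condMean (hcov : Measurable cov) (hh : Measurable h)
    (hf : Integrable f P) (hf0 : ∀ᵐ o ∂P, 0 ≤ f o)
    (hhf : Integrable (fun o => h (cov o) * condMean P cov f (cov o)) P) :
    Integrable (fun o => h (cov o) * f o) P := by
  refine ⟨(hh.comp hcov).aestronglyMeasurable.mul hf.1, ?_⟩
  set F : Ω → ENNReal := fun o => ENNReal.ofReal (f o) with hF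
  have hFm : AEMeasurable F P := hf.1.aemeasurable.ennreal_ofReal
  have hhm : Measurable fun o => ‖h (cov o)‖ₑ := (hh.comp hcov).enorm
  set G : Ω → ENNReal := fun o => ENNReal.ofReal (condMean P cov f (cov o)) with hG
  have hGm : Measurable G := ((measurable_condMean P cov f).comp hcov).ennreal_ofReal
  -- The measures with densities f and E(f | cov) have the same image under `cov`, hence give
  -- |h(cov)| the same integral. The pull-out property is unavailable here, since it presupposes the
  -- integrability to be proved.
  have hGF : ∀ s : Set W, MeasurableSet s → ∫⁻ o in cov ⁻¹' s, G o ∂P = ∫⁻ o in cov ⁻¹' s, F o ∂P := by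
    intro s hs
    rw [hG, hF, ← ofReal_integral_eq_lintegral_ofReal integrable_condMean.integrableOn
      (ae_restrict_of_ae (condMean_nonneg hf0)),
      ← ofReal_integral_eq_lintegral_ofReal hf.integrableOn (ae_restrict_of_ae hf0)]
    simp only [condMean_apply]
    rw [setIntegral_condExp hcov.comap_le hf ⟨s, hs, rfl⟩]
  have hmap : (P.withDensity F).map cov = (P.withDensity G).map cov := by
    ext s hs
    rw [Measure.map_apply hcov hs, Measure.map_apply hcov hs, withDensity_apply _ (hcov hs),
      withDensity_apply _ (hcov hs), hGF s hs]
  have key : ∫⁻ o, F o * ‖h (cov o)‖ₑ ∂P = ∫⁻ o, G o * ‖h (cov o)‖ₑ ∂P := by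
    have h1 : ∫⁻ w, ‖h w‖ₑ ∂(P.withDensity F).map cov = ∫⁻ w, ‖h w‖ₑ ∂(P.withDensity G).map cov := by
      rw [hmap]
    rw [lintegral_map hh.enorm hcov, lintegral_map hh.enorm hcov,
      lintegral_withDensity_eq_lintegral_mul₀ hFm hhm.aemeasurable,
      lintegral_withDensity_eq_lintegral_mul₀ hGm.aemeasurable
        hhm.aemeasurable] at h1
    exact h1
  have e1 : ∫⁻ o, ‖h (cov o) * f o‖ₑ ∂P = ∫⁻ o, F o * ‖h (cov o)‖ₑ ∂P := by
    refine lintegral_congr_ae (hf0.mono fun o ho => ?_)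
    simp only [hF, enorm_mul, Real.enorm_of_nonneg ho]
    rw [mul_comm]
  have e2 : ∫⁻ o, ‖h (cov o) * condMean P cov f (cov o)‖ₑ ∂P = ∫⁻ o, G o * ‖h (cov o)‖ₑ ∂P := by
    refine lintegral_congr_ae ((condMean_nonneg (cov := cov) hf0).mono fun o ho => ?_)
    simp only [hG, enorm_mul, Real.enorm_of_nonneg ho]
    rw [mul_comm]
  rw [HasFiniteIntegral, e1, key, ← e2]
  exact hhf.2

theorem condMean_unique {k : W → ℝ} (hcov : Measurable cov) (hf : Integrable f P)
    (hk : Measurable k) (hki : Integrable (fun o => k (cov o)) P)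
    (heq : ∀ s : Set W, MeasurableSet s →
      ∫ o in cov ⁻¹' s, k (cov o) ∂P = ∫ o in cov ⁻¹' s, f o ∂P) :
    ∀ᵐ o ∂P, condMean P cov f (cov o) = k (cov o) := by
  simp only [condMean_apply]
  refine EventuallyEq.symm (ae_eq_condExp_of_forall_setIntegral_eq hcov.comap_le hf
    (fun _ _ _ => hki.integrableOn) ?_ (stronglyMeasurable_comp_cov hk).aestronglyMeasurable)
  rintro _ ⟨s, hs, rfl⟩ -
  exact heq s hs

theorem setIntegral_condMean (hcov : Measurable cov) (hf : Integrable f P) {s : Set W}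
    (hs : MeasurableSet s) :
    ∫ o in cov ⁻¹' s, condMean P cov f (cov o) ∂P = ∫ o in cov ⁻¹' s, f o ∂P := by
  simp only [condMean_apply]
  exact setIntegral_condExp hcov.comap_le hf ⟨s, hs, rfl⟩

/-- The tower property, for a coarser covariate. -/
theorem condMean_condMean {V : Type*} [MeasurableSpace V] {p : W → V} (hcov : Measurable cov)
    (hp : Measurable p) (hf : Integrable f P) :
    ∀ᵐ o ∂P, condMean P (p ∘ cov) f (p (cov o))
      = condMean P (p ∘ cov) (fun o => condMean P cov f (cov o)) (p (cov o)) := by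
  have h1 := condMean_unique (k := condMean P (p ∘ cov) (fun o => condMean P cov f (cov o)))
    (hp.comp hcov) hf (measurable_condMean _ _ _) integrable_condMean (fun s hs => by
      rw [setIntegral_condMean (hp.comp hcov) integrable_condMean hs, Set.preimage_comp,
        setIntegral_condMean hcov hf (hp hs)])
  exact h1

end Conditional

/-! ### Change of law by a density bounded above and away from zero. -/

section Reweight

variable {Ω : Type u} [MeasurableSpace Ω] {W : Type v} [MeasurableSpace W]

/-- The law with density `r` with respect to `P`. -/
noncomputable abbrev reweight (P : Measure Ω) (r : Ω → ℝ) : Measure Ω :=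
  P.withDensity (fun o => ENNReal.ofReal (r o))

/-- `r` is measurable with values in `[c, C]`, where `c > 0`. -/
structure IsBddDensity (r : Ω → ℝ) (c C : ℝ) : Prop where
  meas : Measurable r
  pos : 0 < c
  mem : ∀ o, c ≤ r o ∧ r o ≤ C

variable {P : Measure Ω} {cov : Ω → W} {f r : Ω → ℝ} {c C : ℝ}

theorem IsBddDensity.r_pos (hr : IsBddDensity r c C) (o : Ω) : 0 < r o :=
  hr.pos.trans_le (hr.mem o).1

theorem IsBddDensity.abs_le (hr : IsBddDensity r c C) (o : Ω) : |r o| ≤ C := by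
  rw [abs_of_pos (hr.r_pos o)]
  exact (hr.mem o).2

/-- Together with `le_reweight`, each law is dominated by a multiple of the other, so null sets,
integrability and `MemLp` transfer both ways. -/
theorem reweight_le (P : Measure Ω) (hr : IsBddDensity r c C) :
    reweight P r ≤ ENNReal.ofReal C • P := by
  rw [← withDensity_const]
  exact withDensity_mono (ae_of_all _ fun o => ENNReal.ofReal_le_ofReal (hr.mem o).2)

theorem le_reweight (P : Measure Ω) (hr : IsBddDensity r c C) :
    P ≤ (ENNReal.ofReal c)⁻¹ • reweight P r := by
  have hc : ENNReal.ofReal c ≠ 0 := by simpa using hr.pos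
  have h1 : ENNReal.ofReal c • P ≤ reweight P r := by
    rw [← withDensity_const]
    exact withDensity_mono (ae_of_all _ fun o => ENNReal.ofReal_le_ofReal (hr.mem o).1)
  calc P = (ENNReal.ofReal c)⁻¹ • ENNReal.ofReal c • P := by
        rw [smul_smul, ENNReal.inv_mul_cancel hc ENNReal.ofReal_ne_top, one_smul]
    _ ≤ _ := by
        intro s
        simp only [Measure.smul_apply, smul_eq_mul]
        gcongr
        exact h1 s

theorem ae_reweight_iff (hr : IsBddDensity r c C) {p : Ω → Prop} :
    (∀ᵐ o ∂reweight P r, p o) ↔ ∀ᵐ o ∂P, p o := by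
  refine ⟨fun h => ?_, fun h => (withDensity_absolutelyContinuous P _).ae_le h⟩
  have : P ≪ reweight P r := (Measure.absolutelyContinuous_of_le_smul (le_reweight P hr))
  exact this.ae_le h

theorem integrable_reweight_iff (hr : IsBddDensity r c C) :
    Integrable f (reweight P r) ↔ Integrable f P :=
  ⟨fun h => h.of_measure_le_smul (by simpa using hr.pos) (le_reweight P hr),
    fun h => h.of_measure_le_smul ENNReal.ofReal_ne_top (reweight_le P hr)⟩

theorem memLp_reweight_iff (hr : IsBddDensity r c C) {p : ENNReal} :
    MemLp f p (reweight P r) ↔ MemLp f p P :=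
  ⟨fun h => h.of_measure_le_smul (by simpa using hr.pos) (le_reweight P hr),
    fun h => h.of_measure_le_smul ENNReal.ofReal_ne_top (reweight_le P hr)⟩

theorem integral_reweight (hr : IsBddDensity r c C) (f : Ω → ℝ) :
    ∫ o, f o ∂reweight P r = ∫ o, r o * f o ∂P := by
  rw [integral_withDensity_eq_integral_toReal_smul hr.meas.ennreal_ofReal
    (ae_of_all _ fun _ => ENNReal.ofReal_lt_top)]
  simp only [ENNReal.toReal_ofReal (hr.r_pos _).le, smul_eq_mul]

theorem IsBddDensity.integrable_mul (hr : IsBddDensity r c C) (hf : Integrable f P) :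
    Integrable (fun o => r o * f o) P :=
  hf.bdd_mul hr.meas.aestronglyMeasurable (ae_of_all _ hr.abs_le)

theorem IsBddDensity.integrable [IsFiniteMeasure P] (hr : IsBddDensity r c C) : Integrable r P := by
  simpa using hr.integrable_mul (integrable_const (μ := P) (1 : ℝ))

theorem IsBddDensity.isFiniteMeasure [IsFiniteMeasure P] (hr : IsBddDensity r c C) :
    IsFiniteMeasure (reweight P r) :=
  isFiniteMeasure_withDensity_ofReal hr.integrable.2

theorem IsBddDensity.le_condMean [IsFiniteMeasure P] (hr : IsBddDensity r c C)
    (hcov : Measurable cov) : ∀ᵐ o ∂P, c ≤ condMean P cov r (cov o) := by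
  filter_upwards [condMean_mono (cov := cov) (integrable_const c) hr.integrable
    (ae_of_all P fun o => (hr.mem o).1)] with o ho
  rwa [condMean_const hcov] at ho

theorem IsBddDensity.condMean_le [IsFiniteMeasure P] (hr : IsBddDensity r c C)
    (hcov : Measurable cov) : ∀ᵐ o ∂P, condMean P cov r (cov o) ≤ C := by
  filter_upwards [condMean_mono (cov := cov) hr.integrable (integrable_const C)
    (ae_of_all P fun o => (hr.mem o).2)] with o ho
  rwa [condMean_const hcov] at ho

/-- Bayes' formula. -/
theorem condMean_reweight [IsFiniteMeasure P] (hcov : Measurable cov) (hr : IsBddDensity r c C)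
    (hf : Integrable f P) :
    ∀ᵐ o ∂P, condMean P cov (fun o => r o * f o) (cov o)
      = condMean P cov r (cov o) * condMean (reweight P r) cov f (cov o) := by
  have hfin := hr.isFiniteMeasure (P := P)
  set k := condMean (reweight P r) cov f
  have hk : Measurable k := measurable_condMean _ _ _
  have hki : Integrable (fun o => k (cov o)) P :=
    (integrable_reweight_iff hr).1 integrable_condMean
  have hkr : Integrable (fun o => k (cov o) * r o) P := by
    simpa only [mul_comm] using hr.integrable_mul hki
  have h1 := condMean_mul hk hr.integrable hkr
  -- Over a preimage under `cov`, the P-integral of r f is the integral of f under the new law,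
  -- hence that of k(cov), hence the P-integral of k(cov) r.
  have h2 := condMean_unique (k := fun w => condMean P cov (fun o => k (cov o) * r o) w) hcov
    (hr.integrable_mul hf) (measurable_condMean _ _ _) integrable_condMean (fun s hs => by
      rw [setIntegral_condMean hcov hkr hs]
      have h3 := setIntegral_condMean (P := reweight P r) hcov
        ((integrable_reweight_iff hr).2 hf) hs
      rw [← integral_indicator (hcov hs), ← integral_indicator (hcov hs),
        integral_reweight hr, integral_reweight hr] at h3
      rw [← integral_indicator (hcov hs), ← integral_indicator (hcov hs)]
      simp only [← Set.indicator_mul_right] at h3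
      simpa only [mul_comm] using h3)
  filter_upwards [h1, h2] with o h1 h2
  rw [h2, h1, mul_comm]

theorem IsNonparametric.reweight_mem {M : Set (Measure Ω)} (hM : IsNonparametric M) (hP : P ∈ M)
    (hr : IsBddDensity r c C) (h1 : ∫ o, r o ∂P = 1) : reweight P r ∈ M :=
  hM.closed P hP r c C hr.meas hr.pos hr.mem h1

end Reweight

/-! ### Linear paths of densities with bounded score. -/

section LinearPath

variable {Ω : Type u} [MeasurableSpace Ω] {W : Type v} [MeasurableSpace W]

/-- The linear path of densities with score `g`. -/
def linearDensity (g : Ω → ℝ) (t : ℝ) (o : Ω) : ℝ := 1 + t * g o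

variable {P : Measure Ω} {cov : Ω → W} {f g : Ω → ℝ} {b t : ℝ}

theorem isBddDensity_linearDensity (hg : Measurable g) (hb : ∀ o, |g o| ≤ b) (ht : |t| * b ≤ 1 / 2) :
    IsBddDensity (linearDensity g t) (1 / 2) (3 / 2) := by
  refine ⟨measurable_const.add (hg.const_mul t), by norm_num, fun o => ?_⟩
  have h1 : |t * g o| ≤ 1 / 2 := by
    rw [abs_mul]
    exact (mul_le_mul_of_nonneg_left (hb o) (abs_nonneg t)).trans ht
  have h2 := abs_le.1 h1
  unfold linearDensity
  constructor <;> linarith [h2.1, h2.2]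

theorem integrable_bdd_mul (hg : Measurable g) (hb : ∀ o, |g o| ≤ b) (hf : Integrable f P) :
    Integrable (fun o => g o * f o) P :=
  hf.bdd_mul hg.aestronglyMeasurable (ae_of_all _ hb)

theorem integrable_of_bdd [IsFiniteMeasure P] (hg : Measurable g) (hb : ∀ o, |g o| ≤ b) :
    Integrable g P := by
  simpa using integrable_bdd_mul hg hb (integrable_const (μ := P) (1 : ℝ))

theorem integral_linearDensity [IsProbabilityMeasure P] (hg : Integrable g P)
    (h0 : ∫ o, g o ∂P = 0) : ∫ o, linearDensity g t o ∂P = 1 := by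
  unfold linearDensity
  rw [integral_add (integrable_const _) (hg.const_mul t), integral_const_mul, h0]
  simp

theorem linearDensity_zero {Ω : Type u} (g : Ω → ℝ) : linearDensity g 0 = fun _ => 1 := by
  funext o
  simp [linearDensity]

theorem reweight_linearDensity_zero (P : Measure Ω) (g : Ω → ℝ) :
    reweight P (linearDensity g 0) = P := by
  simp [reweight, linearDensity_zero]

theorem integral_reweight_linearDensity (hg : Measurable g) (hb : ∀ o, |g o| ≤ b)
    (ht : |t| * b ≤ 1 / 2) (hf : Integrable f P) :
    ∫ o, f o ∂reweight P (linearDensity g t) = ∫ o, f o ∂P + t * ∫ o, g o * f o ∂P := by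
  rw [integral_reweight (isBddDensity_linearDensity hg hb ht), ← integral_const_mul,
    ← integral_add hf ((integrable_bdd_mul hg hb hf).const_mul t)]
  congr 1 with o
  simp only [linearDensity]
  ring

theorem condMean_linearDensity [IsFiniteMeasure P] (hcov : Measurable cov) (hg : Integrable g P) :
    ∀ᵐ o ∂P, condMean P cov (linearDensity g t) (cov o) = 1 + t * condMean P cov g (cov o) := by
  have h1 := condMean_add (cov := cov) (integrable_const (μ := P) (1 : ℝ)) (hg.const_mul t)
  filter_upwards [h1, condMean_const_mul (P := P) (cov := cov) t g] with o h1 h2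
  rw [← h2, ← condMean_const (P := P) hcov 1 o, ← h1]
  rfl

theorem condMean_linearDensity_mul (hg : Measurable g) (hb : ∀ o, |g o| ≤ b)
    (hf : Integrable f P) :
    ∀ᵐ o ∂P, condMean P cov (fun o => linearDensity g t o * f o) (cov o)
      = condMean P cov f (cov o) + t * condMean P cov (fun o => g o * f o) (cov o) := by
  have hgf := integrable_bdd_mul hg hb hf
  filter_upwards [condMean_add (cov := cov) hf (hgf.const_mul t),
    condMean_const_mul (P := P) (cov := cov) t (fun o => g o * f o)] with o h1 h2
  rw [← h2, ← h1]
  refine congrFun (congrArg _ ?_) _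
  funext o
  simp only [linearDensity]
  ring

/-- The conditional mean along a linear path of densities. -/
theorem condMean_reweight_linearDensity [IsFiniteMeasure P] (hcov : Measurable cov)
    (hg : Measurable g) (hb : ∀ o, |g o| ≤ b) (ht : |t| * b ≤ 1 / 2) (hf : Integrable f P) :
    ∀ᵐ o ∂P, (1 + t * condMean P cov g (cov o)) *
      condMean (reweight P (linearDensity g t)) cov f (cov o)
      = condMean P cov f (cov o) + t * condMean P cov (fun o => g o * f o) (cov o) := by
  filter_upwards [condMean_reweight hcov (isBddDensity_linearDensity hg hb ht) hf,
    condMean_linearDensity (t := t) hcov (integrable_of_bdd hg hb),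
    condMean_linearDensity_mul (t := t) (cov := cov) hg hb hf] with o h1 h2 h3
  rw [← h2, ← h1, h3]

/-- The difference quotient of the density is exactly g for t ≠ 0, so differentiability in quadratic
mean is immediate; a mean-zero score keeps total mass one. -/
theorem isRegularSubmodel_linearDensity {M : Set (Measure Ω)} (hM : IsNonparametric M)
    (hP : P ∈ M) (hg : Measurable g) (hb : ∀ o, |g o| ≤ 1) (h0 : ∫ o, g o ∂P = 0) :
    IsRegularSubmodel M P (fun t => reweight P (linearDensity g t)) g := by
  have := hM.prob P hP
  have hev : ∀ᶠ t in 𝓝 (0 : ℝ), |t| * 1 ≤ 1 / 2 := by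
    filter_upwards [Metric.ball_mem_nhds (0 : ℝ) (show (0 : ℝ) < 1 / 2 by norm_num)] with t ht
    rw [Metric.mem_ball, dist_zero_right, Real.norm_eq_abs] at ht
    linarith
  refine ⟨reweight_linearDensity_zero P g, ?_, ?_, linearDensity g, 1 / 2, 3 / 2, by norm_num,
    fun t => measurable_const.add (hg.const_mul t), ?_, ?_⟩
  · filter_upwards [hev] with t ht
    exact hM.reweight_mem hP (isBddDensity_linearDensity hg hb ht)
      (integral_linearDensity (integrable_of_bdd hg hb) h0)
  · exact MemLp.of_bound hg.aestronglyMeasurable 1 (ae_of_all _ hb)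
  · filter_upwards [hev] with t ht
    exact ⟨(isBddDensity_linearDensity hg hb ht).mem, rfl⟩
  · refine tendsto_const_nhds.congr' ?_
    filter_upwards [self_mem_nhdsWithin] with t ht
    have : (fun o => (linearDensity g t o - 1) / t - g o) = fun _ => (0 : ℝ) := by
      funext o
      have ht' : t ≠ 0 := ht
      simp only [linearDensity]
      field_simp
      ring
    rw [this]
    simp

/-- Bounded mean-zero functions, the scores of linear submodels, separate integrable functions of
equal mean: test against the centred sign of the difference. -/
theorem ae_eq_of_integral_bdd_mul_eq [IsProbabilityMeasure P] {φ ψ : Ω → ℝ} (hφ : Integrable φ P)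
    (hψ : Integrable ψ P) (h0 : ∫ o, φ o ∂P = ∫ o, ψ o ∂P)
    (h : ∀ g : Ω → ℝ, Measurable g → (∀ o, |g o| ≤ 1) → ∫ o, g o ∂P = 0 →
      ∫ o, φ o * g o ∂P = ∫ o, ψ o * g o ∂P) : φ =ᵐ[P] ψ := by
  classical
  have hD := hφ.sub hψ
  set D : Ω → ℝ := hD.1.mk (φ - ψ)
  have hDm : Measurable D := hD.1.stronglyMeasurable_mk.measurable
  have hDe : φ - ψ =ᵐ[P] D := hD.1.ae_eq_mk
  have hDi : Integrable D P := hD.congr hDe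
  set s : Ω → ℝ := fun o => if 0 ≤ D o then 1 else -1 with hs
  have hsm : Measurable s := Measurable.ite (measurableSet_le measurable_const hDm)
    measurable_const measurable_const
  have hsb : ∀ o, |s o| ≤ 1 := fun o => by simp only [hs]; split_ifs <;> simp
  have hsi : Integrable s P := integrable_of_bdd hsm hsb
  set c := ∫ o, s o ∂P
  have hc : |c| ≤ 1 := by
    have := norm_integral_le_of_norm_le_const (μ := P) (f := s) (C := 1) (ae_of_all _ hsb)
    simpa using this
  -- The factor 1/2 brings the centred sign back within [-1, 1]; then |D| = 2Dg + cD, whose two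
  -- integrals vanish.
  set g : Ω → ℝ := fun o => (1 / 2) * (s o - c) with hg
  have hgm : Measurable g := (hsm.sub_const c).const_mul _
  have hgb : ∀ o, |g o| ≤ 1 := fun o => by
    have h1 := abs_le.1 (hsb o)
    have h2 := abs_le.1 hc
    exact abs_le.2 ⟨by simp only [hg]; linarith [h1.1, h2.2], by simp only [hg]; linarith [h1.2, h2.1]⟩
  have hg0 : ∫ o, g o ∂P = 0 := by
    simp only [hg]
    rw [integral_const_mul, integral_sub hsi (integrable_const _)]
    simp [c]
  have h1 := h g hgm hgb hg0
  have hi : ∀ {f : Ω → ℝ}, Integrable f P → Integrable (fun o => f o * g o) P := fun hf => by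
    simpa only [mul_comm] using integrable_bdd_mul hgm hgb hf
  have h2 : ∫ o, D o * g o ∂P = 0 := by
    rw [← integral_congr_ae (f := fun o => φ o * g o - ψ o * g o), integral_sub (hi hφ) (hi hψ), h1,
      sub_self]
    filter_upwards [hDe] with o ho
    rw [← ho, Pi.sub_apply, sub_mul]
  have h3 : ∫ o, D o ∂P = 0 := by
    rw [← integral_congr_ae hDe, integral_sub' hφ hψ, h0, sub_self]
  have h4 : ∫ o, |D o| ∂P = 0 := by
    have e : ∀ o, |D o| = 2 * (D o * g o) + c * D o := fun o => by
      simp only [hg, hs]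
      split_ifs with ho
      · rw [abs_of_nonneg ho]; ring
      · rw [abs_of_neg (not_le.1 ho)]; ring
    simp_rw [e]
    rw [integral_add ((hi hDi).const_mul 2) (hDi.const_mul c), integral_const_mul,
      integral_const_mul, h2, h3]
    simp
  have h5 := (integral_eq_zero_iff_of_nonneg (fun o => abs_nonneg (D o)) hDi.abs).1 h4
  filter_upwards [h5, hDe] with o h5 h6
  have : D o = 0 := by simpa using h5
  rw [this, Pi.sub_apply] at h6
  linarith

end LinearPath

/-! ### The Chernozhukov–Newey class: quadratic behaviour and integrability. -/

section CN

variable {Ω : Type u} [MeasurableSpace Ω] {W : Type v} [MeasurableSpace W]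
  {M : Set (Measure Ω)} {cov : Ω → W} {θ : Measure Ω → ℝ} {m : Ω → (W → ℝ) → ℝ} {q S₀ : Ω → ℝ}
  {P : Measure Ω}

theorem memLp_map_cov_iff (hcov : Measurable cov) {h : W → ℝ} (hh : Measurable h) :
    MemLp h 2 (P.map cov) ↔ MemLp (fun o => h (cov o)) 2 P :=
  memLp_map_measure_iff hh.aestronglyMeasurable hcov.aemeasurable

/-- Only the mean of m(O, h) is linear in h, not m itself. As it factors through L₂ classes, almost
sure equality of the arguments suffices. -/
theorem IsCNRepresentation.integral_add_mul (H : IsCNRepresentation M cov θ m q S₀)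
    (hcov : Measurable cov) (hP : P ∈ M) {h h₁ h₂ : W → ℝ} (hh : Measurable h)
    (hh₁ : Measurable h₁) (hh₂ : Measurable h₂) (hm₁ : MemLp h₁ 2 (P.map cov))
    (hm₂ : MemLp h₂ 2 (P.map cov)) (t : ℝ)
    (he : ∀ᵐ o ∂P, h (cov o) = h₁ (cov o) + t * h₂ (cov o)) :
    ∫ o, m o h ∂P = ∫ o, m o h₁ ∂P + t * ∫ o, m o h₂ ∂P := by
  obtain ⟨L, hL⟩ := H.continuous_linear P hP
  have he' : h₁ + t • h₂ =ᵐ[P.map cov] h := by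
    refine (ae_map_iff hcov.aemeasurable
      (measurableSet_eq_fun (hh₁.add (hh₂.const_smul t)) hh)).2 ?_
    filter_upwards [he] with o ho
    simp [ho]
  have hm : MemLp h 2 (P.map cov) := (hm₁.add (hm₂.const_smul t)).ae_eq he'
  rw [hL h hh hm, hL h₁ hh₁ hm₁, hL h₂ hh₂ hm₂, ← smul_eq_mul, ← map_smul, ← map_add,
    ← MemLp.toLp_const_smul, ← MemLp.toLp_add]
  congr 1
  exact MemLp.toLp_congr _ _ he'.symm

/-- A parameter of the Chernozhukov–Newey class is quadratic along a linear path of densities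
that leaves the law of the covariate fixed. -/
theorem third_difference_eq_zero (hM : IsNonparametric M) (hcov : Measurable cov)
    (hθ : θ ∈ cnClass M cov) (hP : P ∈ M) {u : Ω → ℝ} (hu : Measurable u)
    (hb : ∀ o, |u o| ≤ 1 / 4) (hu0 : ∀ᵐ o ∂P, condMean P cov u (cov o) = 0) :
    θ (reweight P (linearDensity u 2)) - 3 * θ (reweight P (linearDensity u 1))
      + 3 * θ (reweight P (linearDensity u 0)) - θ (reweight P (linearDensity u (-1))) = 0 := by
  obtain ⟨m, q, S₀, H⟩ := hθ
  have := hM.prob P hP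
  have hui : Integrable u P := integrable_of_bdd hu hb
  have hu0' : ∫ o, u o ∂P = 0 := by
    rw [← integral_condMean hcov, integral_congr_ae hu0, integral_zero]
  have ht : ∀ {t : ℝ}, |t| ≤ 2 → |t| * (1 / 4) ≤ 1 / 2 := fun h => by linarith
  have hmem : ∀ {t : ℝ}, |t| ≤ 2 → reweight P (linearDensity u t) ∈ M := fun h =>
    hM.reweight_mem hP (isBddDensity_linearDensity hu hb (ht h)) (integral_linearDensity hui hu0')
  have hL2 : ∀ {t : ℝ}, |t| ≤ 2 → ∀ {h : W → ℝ}, Measurable h →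
      (MemLp h 2 ((reweight P (linearDensity u t)).map cov) ↔ MemLp h 2 (P.map cov)) := by
    intro t h k hk
    rw [memLp_map_cov_iff hcov hk, memLp_map_cov_iff hcov hk,
      memLp_reweight_iff (isBddDensity_linearDensity hu hb (ht h))]
  set q0 := condMean P cov q
  set q1 := condMean P cov (fun o => u o * q o)
  have hq0 : Measurable q0 := measurable_condMean _ _ _
  have hq1 : Measurable q1 := measurable_condMean _ _ _
  have ha : ∀ {t : ℝ}, |t| ≤ 2 → ∀ᵐ o ∂P,
      condMean (reweight P (linearDensity u t)) cov q (cov o) = q0 (cov o) + t * q1 (cov o) := by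
    intro t h
    filter_upwards [condMean_reweight_linearDensity hcov hu hb (ht h) (H.integrable_q P hP),
      hu0] with o h1 h2
    rw [h2] at h1
    simpa using h1
  have hm0 : MemLp q0 2 (P.map cov) := H.memLp_a P hP
  -- The slope q1 is the difference of the conditional means of q at t = 1 and t = 0, both square
  -- integrable because both laws are in the model.
  have hm1 : MemLp q1 2 (P.map cov) := by
    have h1 : |(1 : ℝ)| ≤ 2 := by norm_num
    have h2 := (hL2 h1 (measurable_condMean _ _ _)).1 (H.memLp_a _ (hmem h1))
    rw [memLp_map_cov_iff hcov (measurable_condMean _ _ _)] at h2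
    rw [memLp_map_cov_iff hcov hq0] at hm0
    rw [memLp_map_cov_iff hcov hq1]
    refine (h2.sub hm0).ae_eq ?_
    filter_upwards [ha h1] with o ho
    rw [Pi.sub_apply, ho]
    ring
  -- One factor t comes from the affine nuisance function and one from the density, so the degree is
  -- two; the third difference at unit spacing annihilates it.
  have key : ∀ {t : ℝ}, |t| ≤ 2 → θ (reweight P (linearDensity u t))
      = ((∫ o, m o q0 ∂P) + t * ∫ o, u o * m o q0 ∂P)
        + t * ((∫ o, m o q1 ∂P) + t * ∫ o, u o * m o q1 ∂P)
        + ((∫ o, S₀ o ∂P) + t * ∫ o, u o * S₀ o ∂P) := by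
    intro t h
    rw [H.eq _ (hmem h), H.integral_add_mul hcov (hmem h) (measurable_condMean _ _ _) hq0 hq1
      ((hL2 h hq0).2 hm0) ((hL2 h hq1).2 hm1) t
      ((ae_reweight_iff (isBddDensity_linearDensity hu hb (ht h))).2 (ha h)),
      integral_reweight_linearDensity hu hb (ht h) (H.integrable_m P hP q0 hq0 hm0),
      integral_reweight_linearDensity hu hb (ht h) (H.integrable_m P hP q1 hq1 hm1),
      integral_reweight_linearDensity hu hb (ht h) (H.integrable_S₀ P hP)]
  rw [key (t := 2) (by norm_num), key (t := 1) (by norm_num), key (t := 0) (by norm_num),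
    key (t := -1) (by norm_num)]
  ring

/-- The conditional mean of `|q|` is square integrable, as the model is locally unrestricted. -/
theorem IsCNRepresentation.memLp_condMean_abs (H : IsCNRepresentation M cov θ m q S₀)
    (hM : IsNonparametric M) (hcov : Measurable cov) (hP : P ∈ M) :
    MemLp (fun o => condMean P cov (fun o => |q o|) (cov o)) 2 P := by
  classical
  have := hM.prob P hP
  have hq := H.integrable_q P hP
  -- Tilting by the sign of q isolates |q| = 2sq - 3q. The conditional mean of sq is controlled by
  -- that of q under the law with density s/κ, which is also in the model.
  set s : Ω → ℝ := fun o => if 0 ≤ q o then 2 else 1 with hs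
  have hsm : Measurable s := Measurable.ite (measurableSet_le measurable_const H.measurable_q)
    measurable_const measurable_const
  have hs1 : ∀ o, 1 ≤ s o ∧ s o ≤ 2 := fun o => by simp only [hs]; split_ifs <;> norm_num
  have hsi : Integrable s P := (IsBddDensity.mk hsm one_pos hs1).integrable
  set κ := ∫ o, s o ∂P with hκ
  have hκ0 : 0 < κ := by
    have : ∫ _, (1 : ℝ) ∂P ≤ κ := integral_mono (integrable_const _) hsi fun o => (hs1 o).1
    simp at this
    linarith
  have hr : IsBddDensity (fun o => κ⁻¹ * s o) (κ⁻¹ * 1) (κ⁻¹ * 2) := by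
    refine ⟨hsm.const_mul _, by positivity, fun o => ⟨?_, ?_⟩⟩
    · exact mul_le_mul_of_nonneg_left (hs1 o).1 (by positivity)
    · exact mul_le_mul_of_nonneg_left (hs1 o).2 (by positivity)
  have hQ := hM.reweight_mem hP hr (by
    rw [integral_const_mul]
    exact inv_mul_cancel₀ hκ0.ne')
  have h1 := (memLp_reweight_iff hr).1
    ((memLp_map_cov_iff hcov (measurable_condMean _ _ _)).1 (H.memLp_a _ hQ))
  have h2 := (memLp_map_cov_iff hcov (measurable_condMean _ _ _)).1 (H.memLp_a P hP)
  have h3 : MemLp (fun o => condMean P cov (fun o => κ⁻¹ * s o * q o) (cov o)) 2 P := by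
    refine MemLp.of_le_mul (c := κ⁻¹ * 2) h1
      ((measurable_condMean _ _ _).comp hcov).aestronglyMeasurable ?_
    filter_upwards [condMean_reweight hcov hr hq, hr.le_condMean (P := P) hcov,
      hr.condMean_le (P := P) hcov] with o e1 e2 e3
    rw [e1, norm_mul, Real.norm_of_nonneg (hr.pos.le.trans e2)]
    exact mul_le_mul_of_nonneg_right e3 (norm_nonneg _)
  refine ((h3.const_mul (2 * κ)).sub (h2.const_mul 3)).ae_eq ?_
  filter_upwards [condMean_sub (cov := cov) ((hr.integrable_mul hq).const_mul (2 * κ))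
    (hq.const_mul 3), condMean_const_mul (P := P) (cov := cov) (2 * κ)
      (fun o => κ⁻¹ * s o * q o), condMean_const_mul (P := P) (cov := cov) 3 q] with o e1 e2 e3
  rw [Pi.sub_apply, ← e2, ← e3, ← e1]
  refine congrFun (congrArg _ ?_) _
  funext o
  simp only [hs]
  split_ifs with ho
  · rw [abs_of_nonneg ho]; field_simp; ring
  · rw [abs_of_neg (not_le.1 ho)]; field_simp; ring

/-- The statistic q need not be square integrable; it suffices that E(|q| | cov) is, since
|h(cov)||q| has the conditional mean |h(cov)| E(|q| | cov). -/
theorem IsCNRepresentation.integrable_mul_q (H : IsCNRepresentation M cov θ m q S₀)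
    (hM : IsNonparametric M) (hcov : Measurable cov) (hP : P ∈ M) {h : W → ℝ} (hh : Measurable h)
    (hL : MemLp (fun o => h (cov o)) 2 P) : Integrable (fun o => h (cov o) * q o) P := by
  have := hM.prob P hP
  have h1 := integrable_mul_of_condMean hcov hh (H.integrable_q P hP).abs
    (ae_of_all _ fun o => abs_nonneg _) (hL.integrable_mul (H.memLp_condMean_abs hM hcov hP))
  refine h1.mono ((hh.comp hcov).aestronglyMeasurable.mul H.measurable_q.aestronglyMeasurable)
    (ae_of_all _ fun o => ?_)
  simp

end CN

/-! ### Regular Chernozhukov–Newey parameters have the mixed bias property. -/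

section RegularCN

variable {Ω : Type u} [MeasurableSpace Ω] {W : Type v} [MeasurableSpace W]
  {M : Set (Measure Ω)} {cov : Ω → W} {θ : Measure Ω → ℝ} {m : Ω → (W → ℝ) → ℝ} {q S₀ : Ω → ℝ}
  {R : Measure Ω → W → ℝ} {P : Measure Ω}

/-- The influence function of a parameter of the Chernozhukov–Newey class. -/
noncomputable def cnInfluence (cov : Ω → W) (θ : Measure Ω → ℝ) (m : Ω → (W → ℝ) → ℝ)
    (q S₀ : Ω → ℝ) (R : Measure Ω → W → ℝ) (P : Measure Ω) (o : Ω) : ℝ :=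
  m o (condMean P cov q)
    + (R P (cov o) * q o - R P (cov o) * condMean P cov q (cov o)) + (S₀ o - θ P)

theorem IsRieszFamily.integral_m (HR : IsRieszFamily M cov m R) (hcov : Measurable cov)
    (hP : P ∈ M) {h : W → ℝ} (hh : Measurable h) (hL : MemLp h 2 (P.map cov)) :
    ∫ o, m o h ∂P = ∫ o, R P (cov o) * h (cov o) ∂P := by
  rw [(HR P hP).2.2 h hh hL, integral_map hcov.aemeasurable]
  exact ((HR P hP).1.mul hh).aestronglyMeasurable

theorem IsRieszFamily.memLp_comp (HR : IsRieszFamily M cov m R) (hcov : Measurable cov)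
    (hP : P ∈ M) : MemLp (fun o => R P (cov o)) 2 P :=
  (memLp_map_cov_iff hcov (HR P hP).1).1 (HR P hP).2.1

theorem IsCNRepresentation.memLp_comp (H : IsCNRepresentation M cov θ m q S₀)
    (hcov : Measurable cov) (hP : P ∈ M) : MemLp (fun o => condMean P cov q (cov o)) 2 P :=
  (memLp_map_cov_iff hcov (measurable_condMean _ _ _)).1 (H.memLp_a P hP)

/-- The pathwise derivative of a parameter of the Chernozhukov–Newey class, for a bounded score. -/
theorem IsCNRepresentation.hasDerivAt (H : IsCNRepresentation M cov θ m q S₀)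
    (HR : IsRieszFamily M cov m R) (hM : IsNonparametric M) (hcov : Measurable cov) (hP : P ∈ M)
    {g : Ω → ℝ} (hg : Measurable g) (hb : ∀ o, |g o| ≤ 1) (hg0 : ∫ o, g o ∂P = 0) :
    HasDerivAt (fun t => θ (reweight P (linearDensity g t)))
      (∫ o, g o * m o (condMean P cov q) ∂P
        + ∫ o, R P (cov o) * (condMean P cov (fun o => g o * q o) (cov o)
            - condMean P cov q (cov o) * condMean P cov g (cov o)) ∂P
        + ∫ o, g o * S₀ o ∂P) 0 := by
  have := hM.prob P hP
  have hgi : Integrable g P := integrable_of_bdd hg hb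
  have hmem : ∀ {t : ℝ}, |t| * 1 ≤ 1 / 2 → reweight P (linearDensity g t) ∈ M := fun h =>
    hM.reweight_mem hP (isBddDensity_linearDensity hg hb h) (integral_linearDensity hgi hg0)
  have hL2 : ∀ {t : ℝ}, |t| * 1 ≤ 1 / 2 → ∀ {h : W → ℝ}, Measurable h →
      (MemLp h 2 ((reweight P (linearDensity g t)).map cov)
        ↔ MemLp (fun o => h (cov o)) 2 P) := by
    intro t h k hk
    rw [memLp_map_cov_iff hcov hk, memLp_reweight_iff (isBddDensity_linearDensity hg hb h)]
  set A := condMean P cov q with hAdef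
  set G := condMean P cov g
  set B := condMean P cov (fun o => g o * q o)
  have hA : Measurable A := measurable_condMean _ _ _
  have hG : Measurable G := measurable_condMean _ _ _
  have hB : Measurable B := measurable_condMean _ _ _
  -- This is the derivative at t = 0 of the conditional mean of q, which along the path is (A +
  -- tB)/(1 + tG); the difference quotient is therefore k/(1 + tG).
  set k : W → ℝ := fun w => B w - A w * G w with hk
  have hkm : Measurable k := hB.sub (hA.mul hG)
  have hAL : MemLp (fun o => A (cov o)) 2 P := H.memLp_comp hcov hP
  have hG1 : ∀ᵐ o ∂P, |G (cov o)| ≤ 1 := by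
    filter_upwards [abs_condMean_le (cov := cov) hgi (integrable_const 1) (ae_of_all P hb)]
      with o ho
    rwa [condMean_const hcov] at ho
  have hqi := H.integrable_q P hP
  have hkL : MemLp (fun o => k (cov o)) 2 P := by
    refine MemLp.of_le ((H.memLp_condMean_abs hM hcov hP).add hAL.abs)
      (hkm.comp hcov).aestronglyMeasurable ?_
    filter_upwards [hG1, abs_condMean_le (cov := cov) (integrable_bdd_mul hg hb hqi) hqi.abs
      (ae_of_all P fun o => by
        rw [abs_mul]; exact mul_le_of_le_one_left (abs_nonneg _) (hb o))] with o h1 h2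
    have h3 : |A (cov o) * G (cov o)| ≤ |A (cov o)| := by
      rw [abs_mul]
      exact mul_le_of_le_one_right (abs_nonneg _) h1
    rw [Real.norm_eq_abs, Pi.add_apply, Real.norm_eq_abs, Pi.abs_apply]
    refine (abs_sub _ _).trans ((add_le_add h2 h3).trans (le_abs_self _))
  -- the difference quotient of the nuisance function
  set h : ℝ → W → ℝ := fun t w =>
    t⁻¹ * (condMean (reweight P (linearDensity g t)) cov q w - A w) with hh
  have hhm : ∀ t, Measurable (h t) := fun t =>
    ((measurable_condMean _ _ _).sub hA).const_mul _
  have hht : ∀ {t : ℝ}, t ≠ 0 → |t| * 1 ≤ 1 / 2 →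
      ∀ᵐ o ∂P, |h t (cov o)| ≤ 2 * |k (cov o)| ∧
        |h t (cov o) - k (cov o)| ≤ 2 * |t| * |k (cov o)| := by
    intro t ht0 ht
    filter_upwards [hG1, condMean_reweight_linearDensity hcov hg hb ht hqi] with o h1 h2
    have h3 : |t * G (cov o)| ≤ 1 / 2 := by
      rw [abs_mul]
      exact (mul_le_mul_of_nonneg_left h1 (abs_nonneg t)).trans ht
    have h4 := abs_le.1 h3
    have h5 : 0 < 1 + t * G (cov o) := by linarith
    have h6 : h t (cov o) = k (cov o) / (1 + t * G (cov o)) := by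
      rw [eq_div_iff h5.ne']
      simp only [hh, hk]
      field_simp
      linear_combination h2
    have h7 : (1 + t * G (cov o))⁻¹ ≤ 2 := by
      rw [inv_le_comm₀ h5 two_pos]
      linarith
    have h8 : |h t (cov o)| ≤ 2 * |k (cov o)| := by
      rw [h6, div_eq_mul_inv, abs_mul, abs_of_pos (inv_pos.2 h5), mul_comm]
      exact mul_le_mul_of_nonneg_right h7 (abs_nonneg _)
    refine ⟨h8, ?_⟩
    have h9 : h t (cov o) - k (cov o) = -(t * G (cov o) * h t (cov o)) := by
      rw [h6]
      field_simp
      ring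
    rw [h9, abs_neg, abs_mul, abs_mul]
    calc |t| * |G (cov o)| * |h t (cov o)| ≤ |t| * 1 * (2 * |k (cov o)|) := by gcongr
      _ = _ := by ring
  have hhL : ∀ {t : ℝ}, t ≠ 0 → |t| * 1 ≤ 1 / 2 → MemLp (fun o => h t (cov o)) 2 P := by
    intro t ht0 ht
    refine MemLp.of_le_mul (c := 2) hkL ((hhm t).comp hcov).aestronglyMeasurable ?_
    exact (hht ht0 ht).mono fun o ho => ho.1
  have hs : |(1 / 2 : ℝ)| * 1 ≤ 1 / 2 := by norm_num [abs_of_pos]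
  set Q := reweight P (linearDensity g (1 / 2)) with hQdef
  have hQ : Q ∈ M := hmem hs
  have hRL := HR.memLp_comp hcov hP
  have hRQL : MemLp (fun o => R Q (cov o)) 2 P :=
    (memLp_reweight_iff (isBddDensity_linearDensity hg hb hs)).1 (HR.memLp_comp hcov hQ)
  set I := ∫ o, |R P (cov o) * k (cov o)| ∂P
  set J := ∫ o, |R Q (cov o) * k (cov o)| ∂Q
  have hRk : Integrable (fun o => R P (cov o) * k (cov o)) P := hRL.integrable_mul hkL
  have hRQk : Integrable (fun o => R Q (cov o) * k (cov o)) Q :=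
    (integrable_reweight_iff (isBddDensity_linearDensity hg hb hs)).2 (hRQL.integrable_mul hkL)
  have bound1 : ∀ {t : ℝ}, t ≠ 0 → |t| * 1 ≤ 1 / 2 →
      |∫ o, m o (h t) ∂P - ∫ o, R P (cov o) * k (cov o) ∂P| ≤ 2 * |t| * I := by
    intro t ht0 ht
    have hi : Integrable (fun o => R P (cov o) * h t (cov o)) P :=
      hRL.integrable_mul (hhL ht0 ht)
    rw [HR.integral_m hcov hP (hhm t) ((memLp_map_cov_iff hcov (hhm t)).2 (hhL ht0 ht)),
      ← integral_sub hi hRk, ← integral_const_mul]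
    rw [← Real.norm_eq_abs]
    refine norm_integral_le_of_norm_le (hRk.abs.const_mul _) ?_
    filter_upwards [hht ht0 ht] with o ho
    rw [← mul_sub, norm_mul, Real.norm_eq_abs, Real.norm_eq_abs, abs_mul]
    calc _ ≤ |R P (cov o)| * (2 * |t| * |k (cov o)|) := by gcongr; exact ho.2
      _ = _ := by ring
  -- Continuity of h ↦ E m(O, h) under P alone does not control E{g m(O, h)}. That term is twice the
  -- difference of E m(O, h) under Q, the law at t = 1/2, and under P, and each mean is bounded
  -- through its own Riesz representer.
  have bound2 : ∀ {t : ℝ}, t ≠ 0 → |t| * 1 ≤ 1 / 2 →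
      |∫ o, g o * m o (h t) ∂P| ≤ 2 * (2 * J + 2 * I) := by
    intro t ht0 ht
    have hL := (memLp_map_cov_iff hcov (hhm t)).2 (hhL ht0 ht)
    have e := integral_reweight_linearDensity hg hb hs (H.integrable_m P hP (h t) (hhm t) hL)
    rw [← hQdef] at e
    have e1 : |∫ o, m o (h t) ∂Q| ≤ 2 * J := by
      rw [HR.integral_m hcov hQ (hhm t) ((hL2 hs (hhm t)).2 (hhL ht0 ht)), ← integral_const_mul]
      rw [← Real.norm_eq_abs]
      refine norm_integral_le_of_norm_le (hRQk.abs.const_mul _) ?_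
      refine (ae_reweight_iff (isBddDensity_linearDensity hg hb hs)).2 ?_
      filter_upwards [hht ht0 ht] with o ho
      rw [norm_mul, Real.norm_eq_abs, Real.norm_eq_abs, abs_mul (R Q (cov o)) (k (cov o))]
      calc _ ≤ |R Q (cov o)| * (2 * |k (cov o)|) := by gcongr; exact ho.1
        _ = _ := by ring
    have e2 : |∫ o, m o (h t) ∂P| ≤ 2 * I := by
      rw [HR.integral_m hcov hP (hhm t) hL, ← integral_const_mul]
      rw [← Real.norm_eq_abs]
      refine norm_integral_le_of_norm_le (hRk.abs.const_mul _) ?_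
      filter_upwards [hht ht0 ht] with o ho
      rw [norm_mul, Real.norm_eq_abs, Real.norm_eq_abs, abs_mul (R P (cov o)) (k (cov o))]
      calc _ ≤ |R P (cov o)| * (2 * |k (cov o)|) := by gcongr; exact ho.1
        _ = _ := by ring
    have e3 : ∫ o, g o * m o (h t) ∂P = 2 * (∫ o, m o (h t) ∂Q - ∫ o, m o (h t) ∂P) := by
      linarith
    rw [e3, abs_mul, abs_two]
    gcongr
    exact (abs_sub _ _).trans (add_le_add e1 e2)
  set d := ∫ o, g o * m o A ∂P + ∫ o, R P (cov o) * k (cov o) ∂P + ∫ o, g o * S₀ o ∂P with hd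
  have hmap : ∀ {h : W → ℝ}, Measurable h → MemLp (fun o => h (cov o)) 2 P →
      MemLp h 2 (P.map cov) := fun hm hl => (memLp_map_cov_iff hcov hm).2 hl
  have main : ∀ {t : ℝ}, |t| * 1 ≤ 1 / 2 →
      |θ (reweight P (linearDensity g t)) - θ P - t * d|
        ≤ (2 * I + 2 * (2 * J + 2 * I)) * |t ^ 2| := by
    intro t ht
    by_cases ht0 : t = 0
    · subst ht0
      rw [reweight_linearDensity_zero]
      simp
    have e1 := H.integral_add_mul hcov (hmem ht) (measurable_condMean _ _ q) hA (hhm t)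
      ((hL2 ht hA).2 hAL) ((hL2 ht (hhm t)).2 (hhL ht0 ht)) t (ae_of_all _ fun o => by
        simp only [hh]
        field_simp
        ring)
    rw [integral_reweight_linearDensity hg hb ht (H.integrable_m P hP A hA (hmap hA hAL)),
      integral_reweight_linearDensity hg hb ht
        (H.integrable_m P hP (h t) (hhm t) (hmap (hhm t) (hhL ht0 ht)))] at e1
    -- The expansion is exact: `bound1` makes the bracket O(t) and `bound2` makes the last integral
    -- O(1), so the error is O(t²).
    have e2 : θ (reweight P (linearDensity g t)) - θ P - t * d
        = t * (∫ o, m o (h t) ∂P - ∫ o, R P (cov o) * k (cov o) ∂P)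
          + t ^ 2 * ∫ o, g o * m o (h t) ∂P := by
      rw [H.eq _ (hmem ht), H.eq P hP, e1,
        integral_reweight_linearDensity hg hb ht (H.integrable_S₀ P hP), hd]
      ring
    rw [e2]
    refine (abs_add_le _ _).trans ?_
    rw [abs_mul, abs_mul]
    calc _ ≤ |t| * (2 * |t| * I) + |t ^ 2| * (2 * (2 * J + 2 * I)) := by
          gcongr
          · exact bound1 ht0 ht
          · exact bound2 ht0 ht
      _ = _ := by
          rw [abs_pow]
          ring
  rw [hasDerivAt_iff_isLittleO]
  have hO : (fun t : ℝ => θ (reweight P (linearDensity g t))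
      - θ (reweight P (linearDensity g 0)) - (t - 0) • d) =O[𝓝 0] (fun t : ℝ => t ^ 2) := by
    refine Asymptotics.IsBigO.of_bound (2 * I + 2 * (2 * J + 2 * I)) ?_
    filter_upwards [Metric.ball_mem_nhds (0 : ℝ) (show (0 : ℝ) < 1 / 2 by norm_num)] with t ht
    rw [Metric.mem_ball, dist_zero_right, Real.norm_eq_abs] at ht
    rw [reweight_linearDensity_zero, sub_zero, smul_eq_mul, Real.norm_eq_abs, Real.norm_eq_abs]
    exact main (by linarith)
  simpa using hO.trans_isLittleO (Asymptotics.isLittleO_pow_id (by norm_num : 1 < 2))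

/-- The terms of the influence function are integrable under the other laws of the model. -/
theorem IsCNRepresentation.integrable_residual (H : IsCNRepresentation M cov θ m q S₀)
    (hM : IsNonparametric M) (hcov : Measurable cov) (hP : P ∈ M) {r a : W → ℝ}
    (hr : Measurable r) (hrL : MemLp (fun o => r (cov o)) 2 P)
    (haL : MemLp (fun o => a (cov o)) 2 P) :
    Integrable (fun o => r (cov o) * q o - r (cov o) * a (cov o)) P ∧
      ∫ o, (r (cov o) * q o - r (cov o) * a (cov o)) ∂P
        = ∫ o, r (cov o) * condMean P cov q (cov o) ∂P - ∫ o, r (cov o) * a (cov o) ∂P := by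
  have := hM.prob P hP
  have h1 := H.integrable_mul_q hM hcov hP hr hrL
  have h2 : Integrable (fun o => r (cov o) * a (cov o)) P := hrL.integrable_mul haL
  refine ⟨h1.sub h2, ?_⟩
  rw [integral_sub h1 h2, integral_mul_condMean hcov hr (H.integrable_q P hP) h1]

/-- Both sides have mean zero and the same inner product with every bounded score. Existence of an
influence function is assumed; the explicit expression is only known to be integrable beforehand. -/
theorem IsCNRepresentation.influence_ae_eq (H : IsCNRepresentation M cov θ m q S₀)
    (HR : IsRieszFamily M cov m R) (hM : IsNonparametric M) (hcov : Measurable cov) (hP : P ∈ M)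
    {φ : Ω → ℝ} (hφ : IsInfluenceFunction M θ P φ) :
    φ =ᵐ[P] cnInfluence cov θ m q S₀ R P := by
  have := hM.prob P hP
  have hA := measurable_condMean P cov q
  have hAL := H.memLp_comp hcov hP
  have hRL := HR.memLp_comp hcov hP
  have hRm := (HR P hP).1
  have hm := H.integrable_m P hP _ hA (H.memLp_a P hP)
  have hS := H.integrable_S₀ P hP
  have hqi := H.integrable_q P hP
  have hSθ : Integrable (fun o => S₀ o - θ P) P := hS.sub (integrable_const _)
  obtain ⟨hres, hres0⟩ := H.integrable_residual hM hcov hP hRm hRL hAL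
  have hmres : Integrable (fun o => m o (condMean P cov q)
      + (R P (cov o) * q o - R P (cov o) * condMean P cov q (cov o))) P := hm.add hres
  have hci : Integrable (cnInfluence cov θ m q S₀ R P) P := hmres.add hSθ
  have hc0 : ∫ o, cnInfluence cov θ m q S₀ R P o ∂P = 0 := by
    simp only [cnInfluence]
    rw [integral_add hmres hSθ, integral_add hm hres, hres0,
      integral_sub hS (integrable_const _), H.eq P hP]
    simp
  refine ae_eq_of_integral_bdd_mul_eq (hφ.memLp.integrable one_le_two) hci
    (hφ.mean_zero.trans hc0.symm) fun g hg hb hg0 => ?_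
  have hgi : Integrable g P := integrable_of_bdd hg hb
  rw [(hφ.deriv _ g (isRegularSubmodel_linearDensity hM hP hg hb hg0)).unique
    (H.hasDerivAt HR hM hcov hP hg hb hg0)]
  have hRq := H.integrable_mul_q hM hcov hP hRm hRL
  have hRA : Integrable (fun o => R P (cov o) * condMean P cov q (cov o)) P :=
    hRL.integrable_mul hAL
  have hgm := integrable_bdd_mul hg hb hm
  have hgS := integrable_bdd_mul hg hb hS
  have i1 : Integrable (fun o => R P (cov o) * (g o * q o)) P := by
    refine (integrable_bdd_mul hg hb hRq).congr (ae_of_all _ fun o => ?_)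
    simp only []
    ring
  have i2 : Integrable (fun o => R P (cov o) * condMean P cov q (cov o) * g o) P := by
    refine (integrable_bdd_mul hg hb hRA).congr (ae_of_all _ fun o => ?_)
    simp only []
    ring
  have e1 := integral_mul_condMean hcov hRm (integrable_bdd_mul hg hb hqi) i1
  have e2 := integral_mul_condMean (h := fun w => R P w * condMean P cov q w) hcov
    (hRm.mul hA) hgi i2
  have j1 := integrable_mul_condMean hRm (integrable_bdd_mul hg hb hqi) i1
  have j2 := integrable_mul_condMean (h := fun w => R P w * condMean P cov q w)
    (hRm.mul hA) hgi i2
  have e3 : ∫ o, R P (cov o) * (condMean P cov (fun o => g o * q o) (cov o)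
      - condMean P cov q (cov o) * condMean P cov g (cov o)) ∂P
      = ∫ o, R P (cov o) * (g o * q o) ∂P
        - ∫ o, R P (cov o) * condMean P cov q (cov o) * g o ∂P := by
    rw [e1, e2, ← integral_sub j1 j2]
    refine integral_congr_ae (ae_of_all _ fun o => ?_)
    simp only []
    ring
  have e4 : ∫ o, cnInfluence cov θ m q S₀ R P o * g o ∂P
      = ∫ o, g o * m o (condMean P cov q) ∂P + (∫ o, R P (cov o) * (g o * q o) ∂P
        - ∫ o, R P (cov o) * condMean P cov q (cov o) * g o ∂P)
        + (∫ o, g o * S₀ o ∂P - θ P * ∫ o, g o ∂P) := by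
    have k1 : Integrable (fun o => R P (cov o) * (g o * q o)
        - R P (cov o) * condMean P cov q (cov o) * g o) P := i1.sub i2
    have k2 : Integrable (fun o => g o * m o (condMean P cov q) + (R P (cov o) * (g o * q o)
        - R P (cov o) * condMean P cov q (cov o) * g o)) P := hgm.add k1
    have k3 : Integrable (fun o => g o * S₀ o - θ P * g o) P := hgS.sub (hgi.const_mul _)
    rw [← integral_const_mul, ← integral_sub i1 i2, ← integral_sub hgS (hgi.const_mul _),
      ← integral_add hgm k1, ← integral_add k2 k3]
    refine integral_congr_ae (ae_of_all _ fun o => ?_)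
    simp only [cnInfluence]
    ring
  rw [e3, e4, hg0]
  ring

/-- The regular parameters of the Chernozhukov–Newey class have the mixed bias property. -/
theorem regularCNClass_subset_mixedBiasClass (hM : IsNonparametric M) (hcov : Measurable cov) :
    regularCNClass M cov ⊆ mixedBiasClass M cov := by
  classical
  rintro θ ⟨hinf, m, q, S₀, R, H, HR, hL⟩
  choose! φ hφ using hinf
  refine ⟨fun _ => -1, fun P => condMean P cov q, R, measurable_const,
    fun P hP => ⟨measurable_condMean _ _ _, (HR P hP).1⟩, φ, hφ, fun P hP P' hP' => ?_⟩
  have := hM.prob P hP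
  set A := condMean P cov q
  set A' := condMean P' cov q
  have hA : Measurable A := measurable_condMean _ _ _
  have hA' : Measurable A' := measurable_condMean _ _ _
  have hAL : MemLp (fun o => A (cov o)) 2 P := H.memLp_comp hcov hP
  have hAL' : MemLp (fun o => A' (cov o)) 2 P := (memLp_map_cov_iff hcov hA').1 (hL P hP P' hP').1
  have hRL := HR.memLp_comp hcov hP
  have hRL' : MemLp (fun o => R P' (cov o)) 2 P :=
    (memLp_map_cov_iff hcov (HR P' hP').1).1 (hL P hP P' hP').2
  -- The influence function at P' is known only up to P'-null sets; equality of null sets across the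
  -- model carries the formula to P.
  have hae : φ P' =ᵐ[P] cnInfluence cov θ m q S₀ R P' :=
    (hM.ac P hP P' hP').ae_le (H.influence_ae_eq HR hM hcov hP' (hφ P' hP'))
  have hm := H.integrable_m P hP A' hA' (hL P hP P' hP').1
  have hS := H.integrable_S₀ P hP
  have hSθ : Integrable (fun o => S₀ o - θ P') P := hS.sub (integrable_const _)
  obtain ⟨hres, hres0⟩ := H.integrable_residual hM hcov hP (HR P' hP').1 hRL' hAL'
  have hmres : Integrable (fun o => m o A'
      + (R P' (cov o) * q o - R P' (cov o) * A' (cov o))) P := hm.add hres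
  have hci : Integrable (cnInfluence cov θ m q S₀ R P') P := hmres.add hSθ
  have i1 : Integrable (fun o => R P (cov o) * A' (cov o)) P := hRL.integrable_mul hAL'
  have i2 : Integrable (fun o => R P (cov o) * A (cov o)) P := hRL.integrable_mul hAL
  have i3 : Integrable (fun o => R P' (cov o) * A (cov o)) P := hRL'.integrable_mul hAL
  have i4 : Integrable (fun o => R P' (cov o) * A' (cov o)) P := hRL'.integrable_mul hAL'
  have i5 : Integrable (fun o => R P (cov o) * A' (cov o) - R P (cov o) * A (cov o)) P := i1.sub i2
  have i6 : Integrable (fun o => R P' (cov o) * A (cov o) - R P' (cov o) * A' (cov o)) P :=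
    i3.sub i4
  have hprod : (fun o => (R P (cov o) * A' (cov o) - R P (cov o) * A (cov o))
      + (R P' (cov o) * A (cov o) - R P' (cov o) * A' (cov o)))
      = fun o => -1 * (A' (cov o) - A (cov o)) * (R P' (cov o) - R P (cov o)) := by
    funext o
    ring
  refine ⟨hci.congr hae.symm, hprod ▸ i5.add i6, ?_⟩
  have hint : ∫ o, cnInfluence cov θ m q S₀ R P' o ∂P = ∫ o, R P (cov o) * A' (cov o) ∂P
      + (∫ o, R P' (cov o) * A (cov o) ∂P - ∫ o, R P' (cov o) * A' (cov o) ∂P)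
      + (∫ o, S₀ o ∂P - θ P') := by
    simp only [cnInfluence]
    rw [integral_add hmres hSθ, integral_add hm hres, hres0, integral_sub hS (integrable_const _),
      HR.integral_m hcov hP hA' (hL P hP P' hP').1]
    simp [A]
  rw [integral_congr_ae hae, hint, ← hprod, integral_add i5 i6, integral_sub i1 i2,
    integral_sub i3 i4, H.eq P hP, HR.integral_m hcov hP hA (H.memLp_a P hP)]
  ring

end RegularCN

/-! ### L₂ continuity and convergence of conditional means. -/

section Convergence

variable {Ω : Type u} [MeasurableSpace Ω] {W : Type v} [MeasurableSpace W] {P : Measure Ω}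
  {cov : Ω → W} {ι : Type*} {l : Filter ι}

theorem abs_integral_mul_le {u v : Ω → ℝ} (hu : MemLp u 2 P) (hv : MemLp v 2 P) :
    |∫ o, u o * v o ∂P| ≤ (eLpNorm u 2 P * eLpNorm v 2 P).toReal := by
  have hne : eLpNorm u 2 P * eLpNorm v 2 P ≠ ⊤ :=
    ENNReal.mul_ne_top hu.eLpNorm_ne_top hv.eLpNorm_ne_top
  have h1 : ‖∫ o, u o * v o ∂P‖ₑ ≤ eLpNorm u 2 P * eLpNorm v 2 P := by
    refine (enorm_integral_le_lintegral_enorm _).trans ?_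
    rw [← eLpNorm_one_eq_lintegral_enorm]
    have h := eLpNorm_smul_le_mul_eLpNorm (p := 2) (q := 2) (r := 1) (f := v) (φ := u) hv.1 hu.1
    exact h
  rw [← Real.norm_eq_abs, ← toReal_enorm]
  exact ENNReal.toReal_mono hne h1

/-- The integral of a product is continuous for convergence in `L₂`. -/
theorem tendsto_integral_mul {u v : ι → Ω → ℝ} {u₀ v₀ : Ω → ℝ} (hu : ∀ᶠ i in l, MemLp (u i) 2 P)
    (hv : ∀ᶠ i in l, MemLp (v i) 2 P) (hu₀ : MemLp u₀ 2 P) (hv₀ : MemLp v₀ 2 P)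
    (hut : Tendsto (fun i => eLpNorm (u i - u₀) 2 P) l (𝓝 0))
    (hvt : Tendsto (fun i => eLpNorm (v i - v₀) 2 P) l (𝓝 0)) :
    Tendsto (fun i => ∫ o, u i o * v i o ∂P) l (𝓝 (∫ o, u₀ o * v₀ o ∂P)) := by
  have key : ∀ {f g : ι → Ω → ℝ}, (∀ᶠ i in l, MemLp (f i) 2 P) → (∀ᶠ i in l, MemLp (g i) 2 P) →
      Tendsto (fun i => eLpNorm (f i) 2 P * eLpNorm (g i) 2 P) l (𝓝 0) →
      Tendsto (fun i => ∫ o, f i o * g i o ∂P) l (𝓝 0) := by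
    intro f g hf hg ht
    refine squeeze_zero_norm' ?_ ((ENNReal.tendsto_toReal ENNReal.zero_ne_top).comp ht)
    filter_upwards [hf, hg] with i h1 h2
    exact abs_integral_mul_le h1 h2
  have hud : ∀ᶠ i in l, MemLp (u i - u₀) 2 P := hu.mono fun i hi => hi.sub hu₀
  have hvd : ∀ᶠ i in l, MemLp (v i - v₀) 2 P := hv.mono fun i hi => hi.sub hv₀
  -- The expansion uv = (u - u₀)(v - v₀) + (u - u₀)v₀ + u₀(v - v₀) + u₀v₀ leaves three terms that
  -- vanish by Cauchy–Schwarz.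
  have h1 := key hud hvd (by
    simpa using ENNReal.Tendsto.mul hut (Or.inr ENNReal.zero_ne_top) hvt
      (Or.inr ENNReal.zero_ne_top))
  have h2 := key hud (g := fun _ => v₀) (Eventually.of_forall fun _ => hv₀) (by
    simpa using ENNReal.Tendsto.mul_const hut (Or.inr hv₀.eLpNorm_ne_top))
  have h3 := key (f := fun _ => u₀) (Eventually.of_forall fun _ => hu₀) hvd (by
    simpa using ENNReal.Tendsto.const_mul hvt (Or.inr hu₀.eLpNorm_ne_top))
  have h4 := ((h1.add h2).add h3).add_const (∫ o, u₀ o * v₀ o ∂P)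
  rw [add_zero, add_zero, zero_add] at h4
  refine h4.congr' ?_
  filter_upwards [hud, hvd] with i hi hj
  have i1 : Integrable (fun o => (u i - u₀) o * (v i - v₀) o) P := hi.integrable_mul hj
  have i2 : Integrable (fun o => (u i - u₀) o * v₀ o) P := hi.integrable_mul hv₀
  have i3 : Integrable (fun o => u₀ o * (v i - v₀) o) P := hu₀.integrable_mul hj
  have i4 : Integrable (fun o => u₀ o * v₀ o) P := hu₀.integrable_mul hv₀
  have i5 : Integrable (fun o => (u i - u₀) o * (v i - v₀) o + (u i - u₀) o * v₀ o) P := i1.add i2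
  have i6 : Integrable (fun o => (u i - u₀) o * (v i - v₀) o + (u i - u₀) o * v₀ o
      + u₀ o * (v i - v₀) o) P := i5.add i3
  rw [← integral_add i1 i2, ← integral_add i5 i3, ← integral_add i6 i4]
  refine integral_congr_ae (ae_of_all _ fun o => ?_)
  simp only [Pi.sub_apply]
  ring

/-- Dominated convergence to zero in `Lp`. -/
theorem tendsto_eLpNorm_zero_of_dominated [l.IsCountablyGenerated] {p : ENNReal} (hp : p ≠ 0)
    (hp' : p ≠ ⊤) {F : ι → Ω → ℝ} {G : Ω → ℝ} (hF : ∀ᶠ i in l, AEStronglyMeasurable (F i) P)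
    (hG : MemLp G p P) (hb : ∀ᶠ i in l, ∀ᵐ o ∂P, |F i o| ≤ |G o|)
    (hlim : ∀ᵐ o ∂P, Tendsto (fun i => F i o) l (𝓝 0)) :
    Tendsto (fun i => eLpNorm (F i) p P) l (𝓝 0) := by
  have hpos : 0 < p.toReal := ENNReal.toReal_pos hp hp'
  have h1 : Tendsto (fun i => ∫⁻ o, ‖F i o‖ₑ ^ p.toReal ∂P) l (𝓝 (∫⁻ _, 0 ∂P)) := by
    refine tendsto_lintegral_filter_of_dominated_convergence' (fun o => ‖G o‖ₑ ^ p.toReal)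
      ?_ ?_ ?_ ?_
    · exact hF.mono fun i hi => hi.enorm.pow_const _
    · filter_upwards [hb] with i hi
      filter_upwards [hi] with o ho
      gcongr
      rwa [enorm_le_iff_norm_le]
    · exact (lintegral_rpow_enorm_lt_top_of_eLpNorm_lt_top hp hp' hG.2).ne
    · filter_upwards [hlim] with o ho
      have := (ENNReal.continuous_rpow_const (y := p.toReal)).tendsto 0 |>.comp
        (by simpa using ho.enorm)
      simpa [Function.comp_def, ENNReal.zero_rpow_of_pos hpos] using this
  rw [lintegral_zero] at h1
  have h2 := (ENNReal.continuous_rpow_const (y := 1 / p.toReal)).tendsto 0 |>.comp h1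
  simp_rw [eLpNorm_eq_lintegral_rpow_enorm_toReal hp hp']
  simpa [Function.comp_def, ENNReal.zero_rpow_of_pos (inv_pos.2 hpos)] using h2

/-- Conditional expectation contracts L₁, and (r_i - 1)f tends to zero in L₁ by domination with (C +
1)|f|. -/
theorem tendstoInMeasure_condMean [l.IsCountablyGenerated] [IsFiniteMeasure P]
    (hcov : Measurable cov) {f : Ω → ℝ} (hf : Integrable f P) {r : ι → Ω → ℝ} {C : ℝ}
    (hr : ∀ i, Measurable (r i)) (hb : ∀ᶠ i in l, ∀ o, |r i o| ≤ C)
    (hlim : ∀ᵐ o ∂P, Tendsto (fun i => r i o) l (𝓝 1)) :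
    TendstoInMeasure P (fun i o => condMean P cov (fun o => r i o * f o) (cov o)) l
      (fun o => condMean P cov f (cov o)) := by
  have hm : ∀ f : Ω → ℝ, AEStronglyMeasurable (fun o => condMean P cov f (cov o)) P := fun f =>
    ((measurable_condMean P cov f).comp hcov).aestronglyMeasurable
  refine tendstoInMeasure_of_tendsto_eLpNorm one_ne_zero (fun i => hm _) (hm f) ?_
  have h1 : Tendsto (fun i => eLpNorm (fun o => (r i o - 1) * f o) 1 P) l (𝓝 0) := by
    refine tendsto_eLpNorm_zero_of_dominated (G := fun o => (C + 1) * f o) one_ne_zero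
      ENNReal.one_ne_top (Eventually.of_forall fun i =>
        ((hr i).sub_const 1).aestronglyMeasurable.mul hf.1)
      (memLp_one_iff_integrable.2 (hf.const_mul _)) ?_ ?_
    · filter_upwards [hb] with i hi
      refine ae_of_all _ fun o => ?_
      rw [abs_mul, abs_mul]
      refine mul_le_mul_of_nonneg_right ?_ (abs_nonneg _)
      refine (abs_sub _ _).trans ?_
      rw [abs_one]
      exact (add_le_add_left (hi o) 1).trans (le_abs_self _)
    · filter_upwards [hlim] with o ho
      simpa using (ho.sub_const 1).mul_const (f o)
  refine tendsto_of_tendsto_of_tendsto_of_le_of_le' tendsto_const_nhds h1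
    (Eventually.of_forall fun _ => zero_le) ?_
  filter_upwards [hb] with i hi
  have hrf := integrable_bdd_mul (hr i) hi hf
  have h2 : (fun o => condMean P cov (fun o => r i o * f o) (cov o)) - (fun o => condMean P cov f (cov o))
      =ᵐ[P] P[fun o => (r i o - 1) * f o | MeasurableSpace.comap cov inferInstance] := by
    filter_upwards [condMean_sub (cov := cov) hrf hf] with o ho
    rw [Pi.sub_apply, ← ho, condMean_apply]
    simp only [sub_mul, one_mul]
  rw [eLpNorm_congr_ae h2]
  exact eLpNorm_condExp_le_eLpNorm _ le_rfl

end Convergence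

/-! ### The tilted parameter ψ: mixed bias identity and exact increment. -/

section Tilt

variable {𝒵 : Type u} [MeasurableSpace 𝒵] {δ : ℝ} {M : Set (Measure (Obs 𝒵))}
  {P P' : Measure (Obs 𝒵)}

theorem measurable_covZ : Measurable (covZ : Obs 𝒵 → 𝒵) := measurable_snd.snd

theorem measurable_covDZ : Measurable (covDZ : Obs 𝒵 → Bool × 𝒵) := measurable_snd

theorem measurable_obsY : Measurable (obsY : Obs 𝒵 → ℝ) := measurable_fst

theorem measurable_obsD : Measurable (obsD : Obs 𝒵 → ℝ) :=
  Measurable.ite (measurable_snd.fst (measurableSet_singleton true)) measurable_const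
    measurable_const

theorem measurable_tiltW : Measurable (tiltW δ : Obs 𝒵 → ℝ) :=
  measurable_obsD.mul (measurable_obsY.const_mul δ).exp

theorem measurable_tiltA : Measurable (tiltA δ P) :=
  (measurable_condMean _ _ _).div (measurable_condMean _ _ _)

theorem measurable_tiltB : Measurable (tiltB δ P) :=
  (measurable_condMean _ _ _).div (measurable_condMean _ _ _)

theorem obsD_eq_zero_or_one {𝒵 : Type u} (o : Obs 𝒵) : obsD o = 0 ∨ obsD o = 1 := by
  unfold obsD
  split_ifs <;> simp

theorem obsD_mem {𝒵 : Type u} (o : Obs 𝒵) : 0 ≤ obsD o ∧ obsD o ≤ 1 := by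
  rcases obsD_eq_zero_or_one o with h | h <;> rw [h] <;> norm_num

theorem tiltW_nonneg {𝒵 : Type u} (o : Obs 𝒵) : 0 ≤ tiltW δ o :=
  mul_nonneg (obsD_mem o).1 (Real.exp_pos _).le

theorem abs_one_sub_obsD_le {𝒵 : Type u} (o : Obs 𝒵) : |1 - obsD o| ≤ 1 :=
  abs_le.2 ⟨by linarith [(obsD_mem o).2], by linarith [(obsD_mem o).1]⟩

theorem measurable_one_sub_obsD : Measurable (fun o : Obs 𝒵 => 1 - obsD o) :=
  measurable_const.sub measurable_obsD

theorem integrable_one_sub_obsD [IsFiniteMeasure P] : Integrable (fun o => 1 - obsD o) P :=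
  integrable_of_bdd measurable_one_sub_obsD abs_one_sub_obsD_le

theorem tiltA_mul (h : ∀ᵐ o ∂P, 0 < condMean P covZ (tiltW δ) (covZ o)) :
    ∀ᵐ o ∂P, condMean P covZ (tiltYW δ) (covZ o)
      = tiltA δ P (covZ o) * condMean P covZ (tiltW δ) (covZ o) := by
  filter_upwards [h] with o ho
  rw [tiltA, div_mul_cancel₀ _ ho.ne']

theorem tiltB_mul (h : ∀ᵐ o ∂P, 0 < condMean P covZ (tiltW δ) (covZ o)) :
    ∀ᵐ o ∂P, condMean P covZ (fun o => 1 - obsD o) (covZ o)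
      = tiltB δ P (covZ o) * condMean P covZ (tiltW δ) (covZ o) := by
  filter_upwards [h] with o ho
  rw [tiltB, div_mul_cancel₀ _ ho.ne']

/-- Given `Z`, the statistics `1 - D` and `b(Z) D exp(δ Y)` have the same mean. -/
theorem integral_one_sub_obsD_mul [IsFiniteMeasure P] (hW : Integrable (tiltW δ) P)
    (hpos : ∀ᵐ o ∂P, 0 < condMean P covZ (tiltW δ) (covZ o)) {h : 𝒵 → ℝ} (hh : Measurable h)
    (hi : Integrable (fun o => tiltW δ o * h (covZ o) * tiltB δ P (covZ o)) P) :
    Integrable (fun o => (1 - obsD o) * h (covZ o)) P ∧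
      ∫ o, (1 - obsD o) * h (covZ o) ∂P
        = ∫ o, tiltW δ o * h (covZ o) * tiltB δ P (covZ o) ∂P := by
  have hk : Measurable (fun z => h z * tiltB δ P z) := hh.mul measurable_tiltB
  have e : ∀ o, tiltW δ o * h (covZ o) * tiltB δ P (covZ o)
      = (h (covZ o) * tiltB δ P (covZ o)) * tiltW δ o := fun o => by ring
  simp_rw [e] at hi ⊢
  have h1 := integrable_mul_condMean hk hW hi
  have h2 : (fun o => h (covZ o) * tiltB δ P (covZ o) * condMean P covZ (tiltW δ) (covZ o))
      =ᵐ[P] fun o => h (covZ o) * condMean P covZ (fun o => 1 - obsD o) (covZ o) := by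
    filter_upwards [tiltB_mul hpos] with o ho
    rw [ho]
    ring
  -- Since 1 - D ≥ 0, integrability can be recovered from the conditional mean, which is that of
  -- bWh.
  have h3 := integrable_mul_of_condMean measurable_covZ hh integrable_one_sub_obsD
    (ae_of_all P fun o => sub_nonneg.2 (obsD_mem o).2) (h1.congr h2)
  simp only [mul_comm _ (h _)]
  refine ⟨h3, ?_⟩
  rw [integral_mul_condMean measurable_covZ hh integrable_one_sub_obsD h3,
    ← integral_congr_ae h2]
  exact (integral_mul_condMean measurable_covZ hk hW hi).symm

/-- Given `Z`, the statistics `D Y exp(δ Y)` and `a(Z) D exp(δ Y)` have the same mean. -/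
theorem integral_tiltYW_mul [IsFiniteMeasure P] (hW : Integrable (tiltW δ) P)
    (hYW : Integrable (tiltYW δ) P)
    (hpos : ∀ᵐ o ∂P, 0 < condMean P covZ (tiltW δ) (covZ o)) {h : 𝒵 → ℝ} (hh : Measurable h)
    (h1 : Integrable (fun o => tiltYW δ o * h (covZ o)) P)
    (h2 : Integrable (fun o => tiltW δ o * tiltA δ P (covZ o) * h (covZ o)) P) :
    ∫ o, tiltYW δ o * h (covZ o) ∂P = ∫ o, tiltW δ o * tiltA δ P (covZ o) * h (covZ o) ∂P := by
  have hk : Measurable (fun z => h z * tiltA δ P z) := hh.mul measurable_tiltA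
  have e : ∀ o, tiltW δ o * tiltA δ P (covZ o) * h (covZ o)
      = (h (covZ o) * tiltA δ P (covZ o)) * tiltW δ o := fun o => by ring
  simp_rw [e] at h2 ⊢
  simp only [mul_comm (tiltYW δ _)] at h1 ⊢
  rw [integral_mul_condMean measurable_covZ hh hYW h1]
  refine Eq.trans ?_ (integral_mul_condMean measurable_covZ hk hW h2).symm
  refine integral_congr_ae ?_
  filter_upwards [tiltA_mul hpos] with o ho
  rw [ho]
  ring

/-- The influence function of `ψ`. -/
noncomputable def psiInfluence (δ : ℝ) (P : Measure (Obs 𝒵)) (o : Obs 𝒵) : ℝ :=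
  (1 - obsD o) * tiltA δ P (covZ o)
    + tiltB δ P (covZ o) * (tiltW δ o * (obsY o - tiltA δ P (covZ o))) - psi δ P

theorem MNARConditions.memLp_tiltA (hreg : MNARConditions δ M) (hP : P ∈ M) :
    MemLp (fun o => tiltA δ P (covZ o)) 2 P :=
  (memLp_map_cov_iff measurable_covZ measurable_tiltA).1 (hreg.memLp_a P hP)

theorem MNARConditions.memLp_psiInfluence (hreg : MNARConditions δ M) (hM : IsNonparametric M)
    (hP : P ∈ M) : MemLp (psiInfluence δ P) 2 P := by
  have := hM.prob P hP
  refine (MemLp.add ?_ (hreg.memLp_residual P hP)).sub (memLp_const _)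
  refine (hreg.memLp_tiltA hP).of_le (measurable_one_sub_obsD.aestronglyMeasurable.mul
    (hreg.memLp_tiltA hP).1) (ae_of_all _ fun o => ?_)
  rw [norm_mul]
  exact mul_le_of_le_one_left (norm_nonneg _) (abs_one_sub_obsD_le o)

/-- The mixed bias identity for `ψ`. -/
theorem MNARConditions.psi_mixedBias (hreg : MNARConditions δ M) (hM : IsNonparametric M)
    (hP : P ∈ M) (hP' : P' ∈ M) :
    Integrable (psiInfluence δ P') P ∧
    Integrable (fun o => -tiltW δ o * (tiltA δ P' (covZ o) - tiltA δ P (covZ o))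
      * (tiltB δ P' (covZ o) - tiltB δ P (covZ o))) P ∧
    psi δ P' - psi δ P + ∫ o, psiInfluence δ P' o ∂P
      = ∫ o, -tiltW δ o * (tiltA δ P' (covZ o) - tiltA δ P (covZ o))
          * (tiltB δ P' (covZ o) - tiltB δ P (covZ o)) ∂P := by
  have := hM.prob P hP
  have hW := hreg.integrable_W P hP
  have hYW := hreg.integrable_YW P hP
  have hpos := hreg.pos P hP
  have i00 := hreg.integrable_ab P hP P hP P hP
  have i10 := hreg.integrable_ab P hP P' hP' P hP
  have i01 := hreg.integrable_ab P hP P hP P' hP'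
  have i11 := hreg.integrable_ab P hP P' hP' P' hP'
  have j := hreg.integrable_qb P hP P' hP'
  -- Under P, (1 - D)h integrates as b_P W h, and YWb' as a_P W b'. What remains is W times a'b -
  -- a'b' + ab' - ab = -(a' - a)(b' - b).
  obtain ⟨n0, e0⟩ := integral_one_sub_obsD_mul hW hpos (measurable_tiltA (δ := δ) (P := P)) i00
  obtain ⟨n1, e1⟩ := integral_one_sub_obsD_mul hW hpos (measurable_tiltA (δ := δ) (P := P')) i10
  have e2 := integral_tiltYW_mul hW hYW hpos measurable_tiltB j i01
  have k1 : Integrable (fun o => tiltYW δ o * tiltB δ P' (covZ o)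
      - tiltW δ o * tiltA δ P' (covZ o) * tiltB δ P' (covZ o)) P := j.sub i11
  have k2 : Integrable (fun o => (1 - obsD o) * tiltA δ P' (covZ o)
      + (tiltYW δ o * tiltB δ P' (covZ o)
        - tiltW δ o * tiltA δ P' (covZ o) * tiltB δ P' (covZ o))) P := n1.add k1
  have hphi : psiInfluence δ P' = fun o => ((1 - obsD o) * tiltA δ P' (covZ o)
      + (tiltYW δ o * tiltB δ P' (covZ o)
        - tiltW δ o * tiltA δ P' (covZ o) * tiltB δ P' (covZ o))) - psi δ P' := by
    funext o
    simp only [psiInfluence, tiltYW]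
    ring
  have l1 : Integrable (fun o => tiltW δ o * tiltA δ P' (covZ o) * tiltB δ P (covZ o)
      - tiltW δ o * tiltA δ P' (covZ o) * tiltB δ P' (covZ o)) P := i10.sub i11
  have l2 : Integrable (fun o => tiltW δ o * tiltA δ P (covZ o) * tiltB δ P' (covZ o)
      - tiltW δ o * tiltA δ P (covZ o) * tiltB δ P (covZ o)) P := i01.sub i00
  have hprod : (fun o => -tiltW δ o * (tiltA δ P' (covZ o) - tiltA δ P (covZ o))
      * (tiltB δ P' (covZ o) - tiltB δ P (covZ o)))
      = fun o => (tiltW δ o * tiltA δ P' (covZ o) * tiltB δ P (covZ o)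
          - tiltW δ o * tiltA δ P' (covZ o) * tiltB δ P' (covZ o))
        + (tiltW δ o * tiltA δ P (covZ o) * tiltB δ P' (covZ o)
          - tiltW δ o * tiltA δ P (covZ o) * tiltB δ P (covZ o)) := by
    funext o
    ring
  refine ⟨?_, ?_, ?_⟩
  · rw [hphi]
    exact k2.sub (integrable_const _)
  · rw [hprod]
    exact l1.add l2
  · have hpsi : psi δ P = ∫ o, tiltW δ o * tiltA δ P (covZ o) * tiltB δ P (covZ o) ∂P := e0
    rw [hprod, hphi, integral_sub k2 (integrable_const _), integral_add n1 k1, integral_sub j i11,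
      integral_add l1 l2, integral_sub i10 i11, integral_sub i01 i00, e1, e2, hpsi]
    simp
    ring

/-- The bias product vanishes when the two laws coincide. -/
theorem MNARConditions.integral_psiInfluence (hreg : MNARConditions δ M) (hM : IsNonparametric M)
    (hP : P ∈ M) : ∫ o, psiInfluence δ P o ∂P = 0 := by
  have h := (hreg.psi_mixedBias hM hP hP).2.2
  simpa using h

/-- The nuisance functions under a law with bounded density. -/
theorem tilt_reweight [IsFiniteMeasure P] {r : Obs 𝒵 → ℝ} {c C : ℝ} (hr : IsBddDensity r c C)
    {f : Obs 𝒵 → ℝ} (hf : Integrable f P) (hW : Integrable (tiltW δ) P) :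
    ∀ᵐ o ∂P, condMean (reweight P r) covZ f (covZ o)
        / condMean (reweight P r) covZ (tiltW δ) (covZ o)
      = condMean P covZ (fun o => r o * f o) (covZ o)
        / condMean P covZ (fun o => r o * tiltW δ o) (covZ o) := by
  filter_upwards [condMean_reweight measurable_covZ hr hf,
    condMean_reweight measurable_covZ hr hW, hr.le_condMean (P := P) measurable_covZ]
    with o h1 h2 h3
  -- The normaliser E(r | Z) of Bayes' formula cancels in the ratio.
  rw [h1, h2, mul_div_mul_left _ _ (hr.pos.trans_le h3).ne']

theorem tiltB_nonneg (hpos : ∀ᵐ o ∂P, 0 < condMean P covZ (tiltW δ) (covZ o)) :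
    ∀ᵐ o ∂P, 0 ≤ tiltB δ P (covZ o) := by
  filter_upwards [hpos, condMean_nonneg (cov := covZ)
    (ae_of_all P fun o => sub_nonneg.2 (obsD_mem o).2)] with o h1 h2
  exact div_nonneg h2 h1.le

/-- A density in [c, C] multiplies the numerator of b by at most C and its denominator by at least
c. This supplies the dominating function for the remainder of ψ. -/
theorem abs_tiltB_reweight_sub_le [IsFiniteMeasure P] {r : Obs 𝒵 → ℝ} {c C : ℝ}
    (hr : IsBddDensity r c C) (hW : Integrable (tiltW δ) P)
    (hpos : ∀ᵐ o ∂P, 0 < condMean P covZ (tiltW δ) (covZ o)) :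
    ∀ᵐ o ∂P, |tiltB δ (reweight P r) (covZ o) - tiltB δ P (covZ o)|
      ≤ (C / c + 1) * tiltB δ P (covZ o) := by
  have hN : Integrable (fun o : Obs 𝒵 => 1 - obsD o) P := integrable_one_sub_obsD
  have h1 := condMean_mono (cov := covZ) (hr.integrable_mul hN) (hN.const_mul C)
    (ae_of_all P fun o => mul_le_mul_of_nonneg_right (hr.mem o).2 (sub_nonneg.2 (obsD_mem o).2))
  have h2 := condMean_mono (cov := covZ) (hW.const_mul c) (hr.integrable_mul hW)
    (ae_of_all P fun o => mul_le_mul_of_nonneg_right (hr.mem o).1 (tiltW_nonneg o))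
  have h3 := condMean_nonneg (cov := covZ) (ae_of_all P fun o =>
    mul_nonneg (hr.r_pos o).le (sub_nonneg.2 (obsD_mem o).2))
  filter_upwards [tilt_reweight hr hN hW, h1, h2, h3, hpos, tiltB_nonneg hpos,
    condMean_const_mul (P := P) (cov := covZ) C (fun o => 1 - obsD o),
    condMean_const_mul (P := P) (cov := covZ) c (tiltW δ)] with o e h1 h2 h3 h4 h5 h6 h7
  rw [h6] at h1
  rw [h7] at h2
  have hcW : 0 < c * condMean P covZ (tiltW δ) (covZ o) := mul_pos hr.pos h4
  have e' : tiltB δ (reweight P r) (covZ o) = _ := e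
  have h8 : tiltB δ (reweight P r) (covZ o) ≤ C / c * tiltB δ P (covZ o) := by
    rw [e', tiltB, div_mul_div_comm]
    exact div_le_div₀ (h3.trans h1) h1 hcW h2
  have h9 : 0 ≤ tiltB δ (reweight P r) (covZ o) := by
    rw [e']
    exact div_nonneg h3 (hcW.le.trans h2)
  rw [abs_le]
  constructor <;> nlinarith

/-- The increment of `ψ` along a density. -/
theorem MNARConditions.psi_sub (hreg : MNARConditions δ M) (hM : IsNonparametric M) (hP : P ∈ M)
    {r : Obs 𝒵 → ℝ} {c C : ℝ} (hr : IsBddDensity r c C) (hQ : reweight P r ∈ M) :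
    psi δ (reweight P r) - psi δ P = ∫ o, (r o - 1) * (psiInfluence δ P o
      + (tiltB δ (reweight P r) (covZ o) - tiltB δ P (covZ o))
        * (tiltW δ o * (obsY o - tiltA δ P (covZ o)))) ∂P := by
  set Q := reweight P r with hQdef
  have := hM.prob P hP
  have := hM.prob Q hQ
  have i00 := hreg.integrable_ab Q hQ P hP P hP
  have i10 := hreg.integrable_ab Q hQ Q hQ P hP
  have i01 := hreg.integrable_ab Q hQ P hP Q hQ
  have i11 := hreg.integrable_ab Q hQ Q hQ Q hQ
  have jP := hreg.integrable_qb Q hQ P hP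
  have jQ := hreg.integrable_qb Q hQ Q hQ
  have eP := integral_tiltYW_mul (hreg.integrable_W Q hQ) (hreg.integrable_YW Q hQ)
    (hreg.pos Q hQ) measurable_tiltB jP i10
  have eQ := integral_tiltYW_mul (hreg.integrable_W Q hQ) (hreg.integrable_YW Q hQ)
    (hreg.pos Q hQ) measurable_tiltB jQ i11
  have toP : ∀ {f : Obs 𝒵 → ℝ}, Integrable f Q → Integrable f P :=
    fun hf => (integrable_reweight_iff hr).1 hf
  have eP' := integral_tiltYW_mul (hreg.integrable_W P hP) (hreg.integrable_YW P hP)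
    (hreg.pos P hP) measurable_tiltB (toP jP) (toP i00)
  have eQ' := integral_tiltYW_mul (hreg.integrable_W P hP) (hreg.integrable_YW P hP)
    (hreg.pos P hP) measurable_tiltB (toP jQ) (toP i01)
  set X : Obs 𝒵 → ℝ := fun o => (tiltB δ Q (covZ o) - tiltB δ P (covZ o))
        * (tiltW δ o * (obsY o - tiltA δ P (covZ o))) with hX
  have hXe : X = fun o => (tiltYW δ o * tiltB δ Q (covZ o)
        - tiltW δ o * tiltA δ P (covZ o) * tiltB δ Q (covZ o))
      - (tiltYW δ o * tiltB δ P (covZ o)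
        - tiltW δ o * tiltA δ P (covZ o) * tiltB δ P (covZ o)) := by
    funext o
    simp only [hX, tiltYW]
    ring
  have k1 : Integrable (fun o => tiltYW δ o * tiltB δ Q (covZ o)
        - tiltW δ o * tiltA δ P (covZ o) * tiltB δ Q (covZ o)) Q := jQ.sub i01
  have k2 : Integrable (fun o => tiltYW δ o * tiltB δ P (covZ o)
        - tiltW δ o * tiltA δ P (covZ o) * tiltB δ P (covZ o)) Q := jP.sub i00
  have hXi : Integrable X Q := by
    rw [hXe]
    exact k1.sub k2
  -- W(Y - a_P) has conditional mean zero given Z under P. Under Q its conditional mean is that of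
  -- W(a_Q - a_P), so the Q-mean of X is minus the mixed bias (`hXQ`).
  have hXP : ∫ o, X o ∂P = 0 := by
    rw [hXe, integral_sub (toP k1) (toP k2), integral_sub (toP jQ) (toP i01),
      integral_sub (toP jP) (toP i00), eP', eQ']
    ring
  have l1 : Integrable (fun o => tiltW δ o * tiltA δ Q (covZ o) * tiltB δ Q (covZ o)
        - tiltW δ o * tiltA δ P (covZ o) * tiltB δ Q (covZ o)) Q := i11.sub i01
  have l2 : Integrable (fun o => tiltW δ o * tiltA δ Q (covZ o) * tiltB δ P (covZ o)
        - tiltW δ o * tiltA δ P (covZ o) * tiltB δ P (covZ o)) Q := i10.sub i00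
  obtain ⟨hφ, -, hmb⟩ := hreg.psi_mixedBias hM hQ hP
  have hXQ : ∫ o, -tiltW δ o * (tiltA δ P (covZ o) - tiltA δ Q (covZ o))
          * (tiltB δ P (covZ o) - tiltB δ Q (covZ o)) ∂Q = -∫ o, X o ∂Q := by
    have e : (fun o => -tiltW δ o * (tiltA δ P (covZ o) - tiltA δ Q (covZ o))
          * (tiltB δ P (covZ o) - tiltB δ Q (covZ o)))
        = fun o => -((tiltW δ o * tiltA δ Q (covZ o) * tiltB δ Q (covZ o)
            - tiltW δ o * tiltA δ P (covZ o) * tiltB δ Q (covZ o))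
          - (tiltW δ o * tiltA δ Q (covZ o) * tiltB δ P (covZ o)
            - tiltW δ o * tiltA δ P (covZ o) * tiltB δ P (covZ o))) := by
      funext o
      ring
    rw [e, integral_neg, integral_sub l1 l2, integral_sub i11 i01, integral_sub i10 i00, hXe,
      integral_sub k1 k2, integral_sub jQ i01, integral_sub jP i00, eP, eQ]
  have hφX : Integrable (fun o => psiInfluence δ P o + X o) Q := hφ.add hXi
  have hφX0 : ∫ o, (psiInfluence δ P o + X o) ∂P = 0 := by
    rw [integral_add (toP hφ) (toP hXi), hreg.integral_psiInfluence hM hP, hXP, add_zero]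
  -- Both terms have P-mean zero, so r may be replaced by r - 1, the factor that becomes the score
  -- after division by t.
  have hfin : ∫ o, (r o - 1) * (psiInfluence δ P o + X o) ∂P
      = ∫ o, psiInfluence δ P o ∂Q + ∫ o, X o ∂Q := by
    rw [← integral_add hφ hXi, hQdef, integral_reweight hr]
    simp only [sub_mul, one_mul]
    rw [integral_sub (hr.integrable_mul (toP hφX)) (toP hφX), hφX0, sub_zero]
  rw [hfin]
  linarith

end Tilt

/-! ### Influence functions of ψ and of the outcome mean. -/

section Derivative

/-- r_t - 1 is t times a quotient that stays bounded in L₂. -/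
theorem tendsto_eLpNorm_sub_one_of_ratio {Ω : Type u} [MeasurableSpace Ω] {P : Measure Ω}
    {r : ℝ → Ω → ℝ} {g : Ω → ℝ} (hr : ∀ t, Measurable (r t)) (hg : MemLp g 2 P)
    (h : Tendsto (fun t => eLpNorm (fun o => (r t o - 1) / t - g o) 2 P) (𝓝[≠] 0) (𝓝 0)) :
    Tendsto (fun t => eLpNorm (fun o => r t o - 1) 2 P) (𝓝[≠] 0) (𝓝 0) := by
  have h1 : ∀ᶠ t in 𝓝[≠] (0 : ℝ), eLpNorm (fun o => (r t o - 1) / t - g o) 2 P < 1 :=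
    h.eventually_lt_const one_pos
  have hB : (1 : ENNReal) + eLpNorm g 2 P ≠ ⊤ :=
    ENNReal.add_ne_top.2 ⟨ENNReal.one_ne_top, hg.eLpNorm_ne_top⟩
  have h2 : Tendsto (fun t : ℝ => ‖t‖ₑ * (1 + eLpNorm g 2 P)) (𝓝[≠] 0) (𝓝 0) := by
    have h3 : Tendsto (fun t : ℝ => ‖t‖ₑ) (𝓝[≠] 0) (𝓝 0) := by
      have := (continuous_enorm (E := ℝ)).tendsto 0
      rw [enorm_zero] at this
      exact this.mono_left nhdsWithin_le_nhds
    simpa using ENNReal.Tendsto.mul_const h3 (Or.inr hB)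
  refine tendsto_of_tendsto_of_tendsto_of_le_of_le' tendsto_const_nhds h2
    (Eventually.of_forall fun _ => zero_le) ?_
  filter_upwards [h1, self_mem_nhdsWithin] with t ht ht0
  have ht0' : t ≠ 0 := ht0
  have e : (fun o => r t o - 1) = t • ((fun o => (r t o - 1) / t - g o) + g) := by
    funext o
    simp only [Pi.smul_apply, Pi.add_apply, smul_eq_mul]
    field_simp
    ring
  rw [e, eLpNorm_const_smul]
  gcongr
  have hm : AEStronglyMeasurable (fun o => (r t o - 1) / t - g o) P :=
    (((hr t).sub_const 1).div_const t).aestronglyMeasurable.sub hg.1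
  exact (eLpNorm_add_le hm hg.1 one_le_two).trans (by gcongr)

/-- The likelihood ratios of a regular submodel, along the punctured neighbourhoods of `0`. -/
theorem IsRegularSubmodel.exists_ratio {Ω : Type u} [MeasurableSpace Ω] {M : Set (Measure Ω)}
    {P : Measure Ω} [IsFiniteMeasure P] {γ : ℝ → Measure Ω} {g : Ω → ℝ}
    (hγ : IsRegularSubmodel M P γ g) :
    ∃ (r : ℝ → Ω → ℝ) (c C : ℝ), 0 < c ∧ (∀ t, Measurable (r t)) ∧
      (∀ᶠ t in 𝓝[≠] (0 : ℝ), IsBddDensity (r t) c C ∧ γ t = reweight P (r t) ∧ γ t ∈ M) ∧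
      (∀ᶠ t in 𝓝[≠] (0 : ℝ), MemLp (fun o => (r t o - 1) / t) 2 P) ∧
      Tendsto (fun t => eLpNorm (fun o => (r t o - 1) / t - g o) 2 P) (𝓝[≠] 0) (𝓝 0) := by
  obtain ⟨r, c, C, hc, hr, hev, hlim⟩ := hγ.ratio
  have hev' : ∀ᶠ t in 𝓝[≠] (0 : ℝ), IsBddDensity (r t) c C ∧ γ t = reweight P (r t) ∧ γ t ∈ M :=
    (hev.and hγ.mem).filter_mono nhdsWithin_le_nhds |>.mono fun t ht =>
      ⟨⟨hr t, hc, ht.1.1⟩, ht.1.2, ht.2⟩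
  refine ⟨r, c, C, hc, hr, hev', ?_, hlim⟩
  filter_upwards [hev'] with t ht
  refine MemLp.of_bound (((hr t).sub_const 1).div_const t).aestronglyMeasurable ((C + 1) / |t|)
    (ae_of_all _ fun o => ?_)
  rw [norm_div, Real.norm_eq_abs, Real.norm_eq_abs]
  gcongr
  refine (abs_sub _ _).trans ?_
  rw [abs_one]
  linarith [ht.1.abs_le o]

variable {𝒵 : Type u} [MeasurableSpace 𝒵] {δ : ℝ} {M : Set (Measure (Obs 𝒵))}
  {P : Measure (Obs 𝒵)}

/-- The nuisance function `b` is continuous along densities that converge to one in `L₂`, in the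
weighted sense that the remainder of `ψ` needs. -/
theorem MNARConditions.tendsto_eLpNorm_remainder (hreg : MNARConditions δ M)
    (hM : IsNonparametric M) (hP : P ∈ M) {r : ℝ → Obs 𝒵 → ℝ} {c C : ℝ} (hc : 0 < c)
    (hr : ∀ t, Measurable (r t)) (hb : ∀ᶠ t in 𝓝[≠] (0 : ℝ), ∀ o, c ≤ r t o ∧ r t o ≤ C)
    (hlim : Tendsto (fun t => eLpNorm (fun o => r t o - 1) 2 P) (𝓝[≠] 0) (𝓝 0)) :
    Tendsto (fun t => eLpNorm (fun o =>
      (tiltB δ (reweight P (r t)) (covZ o) - tiltB δ P (covZ o))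
        * (tiltW δ o * (obsY o - tiltA δ P (covZ o)))) 2 P) (𝓝[≠] 0) (𝓝 0) := by
  have := hM.prob P hP
  have hW := hreg.integrable_W P hP
  have hpos := hreg.pos P hP
  have hN : Integrable (fun o : Obs 𝒵 => 1 - obsD o) P := integrable_one_sub_obsD
  -- Three successive extractions give almost sure convergence of r, then of the numerator and of
  -- the denominator of b; dominated convergence concludes along that subsequence.
  refine tendsto_of_subseq_tendsto fun ns hns => ?_
  have hm : TendstoInMeasure P (fun n => r (ns n)) atTop (fun _ => 1) :=
    tendstoInMeasure_of_tendsto_eLpNorm two_ne_zero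
      (fun n => (hr (ns n)).aestronglyMeasurable) aestronglyMeasurable_const (hlim.comp hns)
  obtain ⟨n₁, hn₁, hr1⟩ := hm.exists_seq_tendsto_ae
  have hb1 : ∀ᶠ n in atTop, ∀ o, c ≤ r (ns (n₁ n)) o ∧ r (ns (n₁ n)) o ≤ C :=
    (hns.comp hn₁.tendsto_atTop).eventually hb
  have habs : ∀ {t : ℝ}, (∀ o, c ≤ r t o ∧ r t o ≤ C) → ∀ o, |r t o| ≤ C := fun h =>
    (IsBddDensity.mk (hr _) hc h).abs_le
  obtain ⟨n₂, hn₂, hN2⟩ := (tendstoInMeasure_condMean (cov := covZ) measurable_covZ hN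
    (fun n => hr (ns (n₁ n))) (hb1.mono fun n hn => habs hn) hr1).exists_seq_tendsto_ae
  have hb2 : ∀ᶠ n in atTop, ∀ o, c ≤ r (ns (n₁ (n₂ n))) o ∧ r (ns (n₁ (n₂ n))) o ≤ C :=
    hn₂.tendsto_atTop.eventually hb1
  obtain ⟨n₃, hn₃, hW3⟩ := (tendstoInMeasure_condMean (cov := covZ) measurable_covZ hW
    (fun n => hr (ns (n₁ (n₂ n)))) (hb2.mono fun n hn => habs hn)
    (hr1.mono fun o ho => ho.comp hn₂.tendsto_atTop)).exists_seq_tendsto_ae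
  refine ⟨fun n => n₁ (n₂ (n₃ n)), ?_⟩
  have hb3 : ∀ᶠ n in atTop, ∀ o, c ≤ r (ns (n₁ (n₂ (n₃ n)))) o ∧ r (ns (n₁ (n₂ (n₃ n)))) o ≤ C :=
    hn₃.tendsto_atTop.eventually hb2
  have hbm : ∀ Q : Measure (Obs 𝒵), AEStronglyMeasurable (fun o => tiltB δ Q (covZ o)) P :=
    fun Q => (measurable_tiltB.comp measurable_covZ).aestronglyMeasurable
  have hres : AEStronglyMeasurable (fun o => tiltW δ o * (obsY o - tiltA δ P (covZ o))) P :=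
    (measurable_tiltW.mul (measurable_obsY.sub
      (measurable_tiltA.comp measurable_covZ))).aestronglyMeasurable
  refine tendsto_eLpNorm_zero_of_dominated two_ne_zero ENNReal.ofNat_ne_top
    (Eventually.of_forall fun n => ((hbm _).sub (hbm P)).mul hres)
    ((hreg.memLp_residual P hP).const_mul (C / c + 1)) ?_ ?_
  · filter_upwards [hb3] with n hn
    filter_upwards [abs_tiltB_reweight_sub_le (IsBddDensity.mk (hr _) hc hn) hW hpos] with o ho
    rw [abs_mul, ← mul_assoc, abs_mul _ (tiltW δ o * _)]
    exact mul_le_mul_of_nonneg_right (ho.trans (le_abs_self _)) (abs_nonneg _)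
  · obtain ⟨n₀, hn₀⟩ := eventually_atTop.1 hb3
    have hq : ∀ᵐ o ∂P, ∀ n ≥ n₀, tiltB δ (reweight P (r (ns (n₁ (n₂ (n₃ n)))))) (covZ o)
        = condMean P covZ (fun o => r (ns (n₁ (n₂ (n₃ n)))) o * (1 - obsD o)) (covZ o)
          / condMean P covZ (fun o => r (ns (n₁ (n₂ (n₃ n)))) o * tiltW δ o) (covZ o) := by
      rw [ae_all_iff]
      intro n
      by_cases hn : n ≥ n₀
      · filter_upwards [tilt_reweight (IsBddDensity.mk (hr _) hc (hn₀ n hn)) hN hW] with o ho _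
        exact ho
      · exact ae_of_all _ fun o h => absurd h hn
    filter_upwards [hq, hN2, hW3, hpos] with o h1 h2 h3 h4
    have h5 : Tendsto (fun n => tiltB δ (reweight P (r (ns (n₁ (n₂ (n₃ n)))))) (covZ o)) atTop
        (𝓝 (tiltB δ P (covZ o))) := by
      refine ((h2.comp hn₃.tendsto_atTop).div h3 h4.ne').congr' ?_
      filter_upwards [eventually_ge_atTop n₀] with n hn
      exact (h1 n hn).symm
    simpa using (h5.sub_const (tiltB δ P (covZ o))).mul_const
      (tiltW δ o * (obsY o - tiltA δ P (covZ o)))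

/-- In the exact increment of `psi_sub` divided by t, one factor tends to g and the other to ψ¹_P in
L₂, so the integral of the product converges. -/
theorem MNARConditions.hasDerivAt_psi (hreg : MNARConditions δ M) (hM : IsNonparametric M)
    (hP : P ∈ M) {γ : ℝ → Measure (Obs 𝒵)} {g : Obs 𝒵 → ℝ} (hγ : IsRegularSubmodel M P γ g) :
    HasDerivAt (fun t => psi δ (γ t)) (∫ o, psiInfluence δ P o * g o ∂P) 0 := by
  have := hM.prob P hP
  obtain ⟨r, c, C, hc, hr, hev', hgL, hlim⟩ := hγ.exists_ratio
  have hφ := hreg.memLp_psiInfluence hM hP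
  set X : ℝ → Obs 𝒵 → ℝ := fun t o => (tiltB δ (reweight P (r t)) (covZ o) - tiltB δ P (covZ o))
        * (tiltW δ o * (obsY o - tiltA δ P (covZ o))) with hX
  have hXlim : Tendsto (fun t => eLpNorm (X t) 2 P) (𝓝[≠] 0) (𝓝 0) :=
    hreg.tendsto_eLpNorm_remainder hM hP hc hr (hev'.mono fun t ht => ht.1.mem)
      (tendsto_eLpNorm_sub_one_of_ratio hr hγ.score hlim)
  have hXm : ∀ t, AEStronglyMeasurable (X t) P := fun t =>
    ((((measurable_tiltB.sub measurable_tiltB).comp measurable_covZ).mul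
      (measurable_tiltW.mul (measurable_obsY.sub
        (measurable_tiltA.comp measurable_covZ))))).aestronglyMeasurable
  have hXL : ∀ᶠ t in 𝓝[≠] (0 : ℝ), MemLp (X t) 2 P :=
    (hXlim.eventually_lt_const one_pos).mono fun t ht => ⟨hXm t, ht.trans ENNReal.one_lt_top⟩
  have key := tendsto_integral_mul (v := fun t => psiInfluence δ P + X t)
    hgL (hXL.mono fun t ht => hφ.add ht) hγ.score hφ hlim (by simpa using hXlim)
  rw [hasDerivAt_iff_tendsto_slope]
  simp only [mul_comm (psiInfluence δ P _)]
  refine key.congr' ?_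
  filter_upwards [hev'] with t ht
  have hQ : reweight P (r t) ∈ M := ht.2.1 ▸ ht.2.2
  rw [slope_def_field, hγ.zero, ht.2.1, hreg.psi_sub hM hP ht.1 hQ, sub_zero, ← integral_div]
  refine integral_congr_ae (ae_of_all _ fun o => ?_)
  simp only [Pi.add_apply, hX]
  ring

theorem MNARConditions.isInfluenceFunction_psi (hreg : MNARConditions δ M)
    (hM : IsNonparametric M) (hP : P ∈ M) :
    IsInfluenceFunction M (psi δ) P (psiInfluence δ P) :=
  ⟨hreg.memLp_psiInfluence hM hP, hreg.integral_psiInfluence hM hP,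
    fun _ _ hγ => hreg.hasDerivAt_psi hM hP hγ⟩

/-- `ψ` has the mixed bias property. -/
theorem MNARConditions.mixedBiasWith_psi (hreg : MNARConditions δ M) (hM : IsNonparametric M) :
    MixedBiasWith M covZ (psi δ) (fun o => -tiltW δ o) (tiltA δ) (tiltB δ) :=
  ⟨measurable_tiltW.neg, fun _ _ => ⟨measurable_tiltA, measurable_tiltB⟩, psiInfluence δ,
    fun _ hP => hreg.isInfluenceFunction_psi hM hP,
    fun _ hP _ hP' => hreg.psi_mixedBias hM hP hP'⟩

theorem isInfluenceFunction_integral {Ω : Type u} [MeasurableSpace Ω] {M : Set (Measure Ω)}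
    {P : Measure Ω} (hM : IsNonparametric M) (hP : P ∈ M) {f : Ω → ℝ} (hf : MemLp f 2 P) :
    IsInfluenceFunction M (fun Q => ∫ o, f o ∂Q) P (fun o => f o - ∫ o, f o ∂P) := by
  have := hM.prob P hP
  have hfi := hf.integrable one_le_two
  have h0 : ∫ o, (f o - ∫ o, f o ∂P) ∂P = 0 := by
    rw [integral_sub hfi (integrable_const _)]
    simp
  have hf0 : MemLp (fun o => f o - ∫ o, f o ∂P) 2 P := hf.sub (memLp_const _)
  refine ⟨hf0, h0, fun γ g hγ => ?_⟩
  obtain ⟨r, c, C, hc, hr, hev', hgL, hlim⟩ := hγ.exists_ratio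
  have key := tendsto_integral_mul (v := fun _ o => f o - ∫ o, f o ∂P)
    hgL (Eventually.of_forall fun _ => hf0) hγ.score hf0 hlim (by simp)
  rw [hasDerivAt_iff_tendsto_slope]
  simp only [mul_comm _ (g _)]
  refine key.congr' ?_
  filter_upwards [hev'] with t ht
  have hprob : IsProbabilityMeasure (reweight P (r t)) := hM.prob _ (ht.2.1 ▸ ht.2.2)
  have hf0i : Integrable (fun o => f o - ∫ o, f o ∂P) P := hf0.integrable one_le_two
  have e : ∫ o, f o ∂γ t - ∫ o, f o ∂P = ∫ o, (r t o - 1) * (f o - ∫ o, f o ∂P) ∂P := by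
    simp only [sub_mul _ (1 : ℝ), one_mul]
    rw [integral_sub (ht.1.integrable_mul hf0i) hf0i, h0, ← integral_reweight ht.1, ht.2.1,
      integral_sub ((integrable_reweight_iff ht.1).2 hfi) (integrable_const _)]
    simp
  rw [slope_def_field, hγ.zero, e, sub_zero, ← integral_div]
  refine integral_congr_ae (ae_of_all _ fun o => ?_)
  simp only []
  ring

theorem MNARConditions.meanMNAR_eq (hreg : MNARConditions δ M) (hM : IsNonparametric M)
    (hP : P ∈ M) (hY : Integrable obsY P) : meanMNAR δ P = ∫ o, obsY o ∂P + psi δ P := by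
  have := hM.prob P hP
  refine integral_add hY ?_
  exact integrable_bdd_mul measurable_one_sub_obsD abs_one_sub_obsD_le
    ((hreg.memLp_tiltA hP).integrable one_le_two)

/-- The mean of the outcome has the mixed bias property. -/
theorem MNARConditions.mixedBiasWith_meanMNAR (hreg : MNARConditions δ M)
    (hM : IsNonparametric M) (hY : ∀ P ∈ M, MemLp obsY 2 P) :
    MixedBiasWith M covZ (meanMNAR δ) (fun o => -tiltW δ o) (tiltA δ) (tiltB δ) := by
  have hYi : ∀ P ∈ M, Integrable obsY P := fun P hP => by
    have := hM.prob P hP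
    exact (hY P hP).integrable one_le_two
  refine ⟨measurable_tiltW.neg, fun _ _ => ⟨measurable_tiltA, measurable_tiltB⟩,
    fun P o => (obsY o - ∫ o, obsY o ∂P) + psiInfluence δ P o, fun P hP => ?_,
    fun P hP P' hP' => ?_⟩
  · have := hM.prob P hP
    have hψ := hreg.isInfluenceFunction_psi hM hP
    have hI := isInfluenceFunction_integral hM hP (hY P hP)
    refine ⟨hI.memLp.add hψ.memLp, ?_, fun γ g hγ => ?_⟩
    · rw [integral_add (hI.memLp.integrable one_le_two) (hψ.memLp.integrable one_le_two),
        hI.mean_zero, hψ.mean_zero, add_zero]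
    · have hd := (hI.deriv γ g hγ).add (hψ.deriv γ g hγ)
      have i1 : Integrable (fun o => (obsY o - ∫ o, obsY o ∂P) * g o) P :=
        hI.memLp.integrable_mul hγ.score
      have i2 : Integrable (fun o => psiInfluence δ P o * g o) P :=
        hψ.memLp.integrable_mul hγ.score
      simp only [add_mul]
      rw [integral_add i1 i2]
      refine hd.congr_of_eventuallyEq ?_
      filter_upwards [hγ.mem] with t ht
      exact hreg.meanMNAR_eq hM ht (hYi _ ht)
  · have := hM.prob P hP
    obtain ⟨h1, h2, h3⟩ := hreg.psi_mixedBias hM hP hP'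
    have h4 : Integrable (fun o => obsY o - ∫ o, obsY o ∂P') P :=
      (hYi P hP).sub (integrable_const _)
    refine ⟨h4.add h1, h2, ?_⟩
    rw [← h3, integral_add h4 h1, integral_sub (hYi P hP) (integrable_const _),
      hreg.meanMNAR_eq hM hP (hYi P hP), hreg.meanMNAR_eq hM hP' (hYi P' hP')]
    simp
    ring

end Derivative

/-! ### Consequences of a vanishing conditional mean. -/

section ZeroMean

variable {Ω : Type u} [MeasurableSpace Ω] {W : Type v} [MeasurableSpace W] {P : Measure Ω}
  [IsFiniteMeasure P] {cov : Ω → W} {f : Ω → ℝ}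

/-- A statistic that is nonnegative and has conditional mean zero for the values of the covariate
in `E` vanishes there. -/
theorem ae_eq_zero_of_condMean_eq_zero (hcov : Measurable cov) (hf : Integrable f P) {E : Set W}
    (hE : MeasurableSet E) (h0 : ∀ᵐ o ∂P, cov o ∈ E → 0 ≤ f o)
    (hc : ∀ᵐ o ∂P, cov o ∈ E → condMean P cov f (cov o) = 0) :
    ∀ᵐ o ∂P, cov o ∈ E → f o = 0 := by
  have h1 : ∫ o in cov ⁻¹' E, f o ∂P = 0 := by
    rw [← setIntegral_condMean hcov hf hE, setIntegral_congr_ae (hcov hE) hc, integral_zero]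
  have h2 : 0 ≤ᵐ[P.restrict (cov ⁻¹' E)] f := (ae_restrict_iff' (hcov hE)).2 h0
  exact (ae_restrict_iff' (hcov hE)).1 ((setIntegral_eq_zero_iff_of_nonneg_ae h2
    hf.integrableOn).1 h1)

/-- With f = 1 - D this turns h(Z) = 0 on {D = 0} into h(Z) = 0 wherever pr(D = 0 | Z) > 0,
including the points with D = 1. -/
theorem mul_condMean_eq_zero (hcov : Measurable cov) (hf : Integrable f P) {h : W → ℝ}
    (hh : Measurable h) (h0 : ∀ᵐ o ∂P, h (cov o) * f o = 0) :
    ∀ᵐ o ∂P, h (cov o) * condMean P cov f (cov o) = 0 := by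
  have hi : Integrable (fun o => h (cov o) * f o) P :=
    (integrable_zero Ω ℝ P).congr (EventuallyEq.symm h0)
  filter_upwards [condMean_mul hh hf hi, condMean_congr (cov := cov) h0] with o h1 h2
  rw [← h1, h2, condMean_const hcov]

theorem condMean_comp_cov (hcov : Measurable cov) {h : W → ℝ} (hh : Measurable h)
    (hi : Integrable (fun o => h (cov o)) P) :
    ∀ᵐ o ∂P, condMean P cov (fun o => h (cov o)) (cov o) = h (cov o) :=
  condMean_unique hcov hi hh hi fun _ _ => rfl

end ZeroMean

/-! ### Exclusion of ψ from the Chernozhukov–Newey classes. -/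

section NonMembership

variable {𝒵 : Type u} [MeasurableSpace 𝒵] {δ : ℝ} {M : Set (Measure (Obs 𝒵))}
  {P : Measure (Obs 𝒵)} {w : Obs 𝒵 → ℝ}

/-- By the tower property a score centred given (D, Z) is centred given Z, so a single path serves
both covariates. -/
theorem condMean_covZ_eq_zero [IsFiniteMeasure P] {f : Obs 𝒵 → ℝ} (hf : Integrable f P)
    (h0 : ∀ᵐ o ∂P, condMean P covDZ f (covDZ o) = 0) :
    ∀ᵐ o ∂P, condMean P covZ f (covZ o) = 0 := by
  have h1 : ∀ᵐ o ∂P, condMean P covZ f (covZ o)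
      = condMean P covZ (fun o => condMean P covDZ f (covDZ o)) (covZ o) :=
    condMean_condMean (p := Prod.snd) measurable_covDZ measurable_snd hf
  filter_upwards [h1, condMean_congr (cov := covZ) h0] with o h1 h2
  rw [h1, h2, condMean_const measurable_covZ]

/-- The value of `ψ` along a linear path of densities with a score of mean zero given `(D, Z)`. -/
theorem MNARConditions.psi_linearDensity (hreg : MNARConditions δ M) (hM : IsNonparametric M)
    (hP : P ∈ M) (hw : Measurable w) (hb : ∀ o, |w o| ≤ 1 / 4)
    (h0 : ∀ᵐ o ∂P, condMean P covDZ w (covDZ o) = 0) {t : ℝ} (ht : |t| ≤ 2) :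
    Integrable (fun o => (1 - obsD o) * tiltA δ (reweight P (linearDensity w t)) (covZ o)) P ∧
    psi δ (reweight P (linearDensity w t))
      = ∫ o, (1 - obsD o) * tiltA δ (reweight P (linearDensity w t)) (covZ o) ∂P := by
  have := hM.prob P hP
  have hwi : Integrable w P := integrable_of_bdd hw hb
  have hw0 : ∫ o, w o ∂P = 0 := by
    rw [← integral_condMean measurable_covDZ, integral_congr_ae h0, integral_zero]
  have ht' : |t| * (1 / 4) ≤ 1 / 2 := by linarith
  have hr := isBddDensity_linearDensity hw hb ht'
  have hQ : reweight P (linearDensity w t) ∈ M :=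
    hM.reweight_mem hP hr (integral_linearDensity hwi hw0)
  set a := tiltA δ (reweight P (linearDensity w t))
  have haL : MemLp (fun o => a (covZ o)) 2 P := (memLp_reweight_iff hr).1 (hreg.memLp_tiltA hQ)
  have hi : Integrable (fun o => (1 - obsD o) * a (covZ o)) P :=
    integrable_bdd_mul measurable_one_sub_obsD abs_one_sub_obsD_le (haL.integrable one_le_two)
  refine ⟨hi, ?_⟩
  rw [psi, integral_reweight_linearDensity hw hb ht' hi]
  set h : Bool × 𝒵 → ℝ := fun x => (1 - if x.1 then 1 else 0) * a x.2 with hh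
  have hhm : Measurable h := (measurable_const.sub (Measurable.ite
    (measurable_fst (measurableSet_singleton true)) measurable_const measurable_const)).mul
    (measurable_tiltA.comp measurable_snd)
  have hhe : ∀ o : Obs 𝒵, (1 - obsD o) * a (covZ o) = h (covDZ o) := fun o => rfl
  have hhi : Integrable (fun o => h (covDZ o) * w o) P := by
    simp only [mul_comm (h _)]
    exact integrable_bdd_mul hw hb hi
  -- (1 - D)a_t(Z) is a function of (D, Z), whose law the path leaves fixed.
  have e : ∫ o, w o * ((1 - obsD o) * a (covZ o)) ∂P = 0 := by
    simp only [hhe, mul_comm (w _)]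
    rw [integral_mul_condMean measurable_covDZ hhm hwi hhi, integral_congr_ae (g := fun _ => 0),
      integral_zero]
    filter_upwards [h0] with o ho
    rw [ho, mul_zero]
  rw [e, mul_zero, add_zero]

/-- If `ψ` is quadratic along the path with score `w`, then one of the two conditional moments
of `w` that make it non-quadratic vanishes. -/
theorem MNARConditions.moment_eq_zero_of_third_difference (hreg : MNARConditions δ M)
    (hM : IsNonparametric M) (hP : P ∈ M) (hw : Measurable w) (hb : ∀ o, |w o| ≤ 1 / 4)
    (h0 : ∀ᵐ o ∂P, condMean P covDZ w (covDZ o) = 0)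
    (hβ : ∀ᵐ o ∂P, 0 ≤ condMean P covZ (fun o => w o * tiltYW δ o) (covZ o)
      - tiltA δ P (covZ o) * condMean P covZ (fun o => w o * tiltW δ o) (covZ o))
    (h3 : psi δ (reweight P (linearDensity w 2)) - 3 * psi δ (reweight P (linearDensity w 1))
      + 3 * psi δ (reweight P (linearDensity w 0))
      - psi δ (reweight P (linearDensity w (-1))) = 0) :
    ∀ᵐ o ∂P, 0 < condMean P covZ (fun o => 1 - obsD o) (covZ o) →
      condMean P covZ (fun o => w o * tiltYW δ o) (covZ o)
        - tiltA δ P (covZ o) * condMean P covZ (fun o => w o * tiltW δ o) (covZ o) = 0 ∨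
      condMean P covZ (fun o => w o * tiltW δ o) (covZ o) = 0 := by
  have := hM.prob P hP
  have hW := hreg.integrable_W P hP
  have hYW := hreg.integrable_YW P hP
  have hpos := hreg.pos P hP
  set a : ℝ → 𝒵 → ℝ := fun t => tiltA δ (reweight P (linearDensity w t)) with ha
  set A1 := condMean P covZ (fun o => w o * tiltYW δ o)
  set C1 := condMean P covZ (fun o => w o * tiltW δ o)
  set C := condMean P covZ (tiltW δ) with hC
  have hpsi : ∀ {t : ℝ}, |t| ≤ 2 → Integrable (fun o => (1 - obsD o) * a t (covZ o)) P ∧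
      psi δ (reweight P (linearDensity w t)) = ∫ o, (1 - obsD o) * a t (covZ o) ∂P :=
    fun ht => hreg.psi_linearDensity hM hP hw hb h0 ht
  have hat : ∀ {t : ℝ}, |t| ≤ 2 → ∀ᵐ o ∂P, a t (covZ o)
      = (tiltA δ P (covZ o) * C (covZ o) + t * A1 (covZ o)) / (C (covZ o) + t * C1 (covZ o)) := by
    intro t ht
    filter_upwards [tilt_reweight (isBddDensity_linearDensity hw hb
        (show |t| * (1 / 4) ≤ 1 / 2 by linarith)) hYW hW,
      condMean_linearDensity_mul (t := t) (cov := covZ) hw hb hYW,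
      condMean_linearDensity_mul (t := t) (cov := covZ) hw hb hW, tiltA_mul hpos] with o e1 e2 e3 e4
    rw [e2, e3, e4] at e1
    exact e1
  have hC1 : ∀ᵐ o ∂P, |C1 (covZ o)| ≤ 1 / 4 * C (covZ o) := by
    filter_upwards [abs_condMean_le (cov := covZ) (integrable_bdd_mul hw hb hW)
      (hW.const_mul (1 / 4)) (ae_of_all P fun o => by
        rw [abs_mul, abs_of_nonneg (tiltW_nonneg o)]
        exact mul_le_mul_of_nonneg_right (hb o) (tiltW_nonneg o)),
      condMean_const_mul (P := P) (cov := covZ) (1 / 4) (tiltW δ)] with o e1 e2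
    rwa [e2] at e1
  obtain ⟨i2, p2⟩ := hpsi (t := 2) (by norm_num)
  obtain ⟨i1, p1⟩ := hpsi (t := 1) (by norm_num)
  obtain ⟨i0, p0⟩ := hpsi (t := 0) (by norm_num)
  obtain ⟨in1, pn1⟩ := hpsi (t := -1) (by norm_num)
  -- The third difference is taken pointwise in Z, so that of ψ is the mean of (1 - D)K(Z); the sign
  -- of K then turns a zero mean into K = 0 on {D = 0}.
  set K : 𝒵 → ℝ := fun z => a 2 z - 3 * a 1 z + 3 * a 0 z - a (-1) z with hK
  have ham : ∀ t, Measurable (a t) := fun t => measurable_tiltA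
  have hKm : Measurable K := (((ham 2).sub ((ham 1).const_mul 3)).add
    ((ham 0).const_mul 3)).sub (ham (-1))
  have j1 : Integrable (fun o => (1 - obsD o) * a 2 (covZ o)
      - 3 * ((1 - obsD o) * a 1 (covZ o))) P := i2.sub (i1.const_mul 3)
  have j2 : Integrable (fun o => (1 - obsD o) * a 2 (covZ o)
      - 3 * ((1 - obsD o) * a 1 (covZ o)) + 3 * ((1 - obsD o) * a 0 (covZ o))) P :=
    j1.add (i0.const_mul 3)
  have hKe : (fun o => (1 - obsD o) * a 2 (covZ o) - 3 * ((1 - obsD o) * a 1 (covZ o))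
      + 3 * ((1 - obsD o) * a 0 (covZ o)) - (1 - obsD o) * a (-1) (covZ o))
      = fun o => K (covZ o) * (1 - obsD o) := by
    funext o
    simp only [hK]
    ring
  have hKi : Integrable (fun o => K (covZ o) * (1 - obsD o)) P := by
    rw [← hKe]
    exact j2.sub in1
  have hKint : ∫ o, K (covZ o) * (1 - obsD o) ∂P = 0 := by
    rw [← hKe, integral_sub j2 in1, integral_add j1 (i0.const_mul 3),
      integral_sub i2 (i1.const_mul 3), integral_const_mul, integral_const_mul, ← p2, ← p1, ← p0,
      ← pn1, h3]
  have hform : ∀ᵐ o ∂P, 0 ≤ K (covZ o) ∧ (K (covZ o) = 0 →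
      A1 (covZ o) - tiltA δ P (covZ o) * C1 (covZ o) = 0 ∨ C1 (covZ o) = 0) := by
    filter_upwards [hat (t := 2) (by norm_num), hat (t := 1) (by norm_num),
      hat (t := 0) (by norm_num), hat (t := -1) (by norm_num), hC1, hpos, hβ]
      with o e2 e1 e0 en1 hc hc0 hβ
    obtain ⟨l1, l2⟩ := abs_le.1 hc
    have d2 : 0 < C (covZ o) + 2 * C1 (covZ o) := by linarith
    have d1 : 0 < C (covZ o) + C1 (covZ o) := by linarith
    have dn1 : 0 < C (covZ o) - C1 (covZ o) := by linarith
    have hKo : K (covZ o) = 6 * (A1 (covZ o) - tiltA δ P (covZ o) * C1 (covZ o))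
        * C1 (covZ o) ^ 2 / ((C (covZ o) + 2 * C1 (covZ o)) * (C (covZ o) + C1 (covZ o))
          * (C (covZ o) - C1 (covZ o))) := by
      have en1' : a (-1) (covZ o) = (tiltA δ P (covZ o) * C (covZ o) - A1 (covZ o))
          / (C (covZ o) - C1 (covZ o)) := by
        rw [en1]
        congr 1 <;> ring
      have e1' : a 1 (covZ o) = (tiltA δ P (covZ o) * C (covZ o) + A1 (covZ o))
          / (C (covZ o) + C1 (covZ o)) := by
        rw [e1, one_mul, one_mul]
      have e0' : a 0 (covZ o) = tiltA δ P (covZ o) := by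
        rw [e0]
        simp [hc0.ne']
      simp only [hK]
      rw [e2, e1', e0', en1']
      field_simp
      ring
    refine ⟨?_, fun hz => ?_⟩
    · rw [hKo]
      positivity
    · rw [hKo, div_eq_zero_iff] at hz
      rcases hz with hz | hz
      · rcases mul_eq_zero.1 hz with hz | hz
        · exact Or.inl (by linarith)
        · exact Or.inr (pow_eq_zero_iff two_ne_zero |>.1 hz)
      · exact absurd hz (by positivity)
  have hK0 : ∀ᵐ o ∂P, K (covZ o) * (1 - obsD o) = 0 :=
    (integral_eq_zero_iff_of_nonneg_ae (hform.mono fun o ho =>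
      mul_nonneg ho.1 (sub_nonneg.2 (obsD_mem o).2)) hKi).1 hKint
  filter_upwards [mul_condMean_eq_zero measurable_covZ integrable_one_sub_obsD hKm hK0, hform]
    with o e1 e2 hπ
  exact e2.2 ((mul_eq_zero.1 e1).resolve_right hπ.ne')

/-- A score that detects, through `ψ`, whether the outcome is a function of `Z`. -/
theorem MNARConditions.exists_score (hreg : MNARConditions δ M) (hδ : δ ≠ 0)
    (hM : IsNonparametric M) (hP : P ∈ M) :
    ∃ w : Obs 𝒵 → ℝ, Measurable w ∧ (∀ o, |w o| ≤ 1 / 4) ∧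
      (∀ᵐ o ∂P, condMean P covDZ w (covDZ o) = 0) ∧
      (∀ᵐ o ∂P, 0 ≤ condMean P covZ (fun o => w o * tiltYW δ o) (covZ o)
        - tiltA δ P (covZ o) * condMean P covZ (fun o => w o * tiltW δ o) (covZ o)) ∧
      ∀ᵐ o ∂P, (condMean P covZ (fun o => w o * tiltYW δ o) (covZ o)
          - tiltA δ P (covZ o) * condMean P covZ (fun o => w o * tiltW δ o) (covZ o) = 0 ∨
        condMean P covZ (fun o => w o * tiltW δ o) (covZ o) = 0) →
        o.2.1 = true → obsY o = tiltA δ P (covZ o) := by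
  classical
  have := hM.prob P hP
  have hW := hreg.integrable_W P hP
  have hYW := hreg.integrable_YW P hP
  have hpos := hreg.pos P hP
  set a := tiltA δ P with ha
  have ham : Measurable a := measurable_tiltA
  set v : Obs 𝒵 → ℝ := fun o => if o.2.1 = true ∧ a (covZ o) < obsY o then 1 else 0 with hv
  have hvm : Measurable v := by
    refine Measurable.ite ?_ measurable_const measurable_const
    exact (measurable_snd.fst (measurableSet_singleton true)).inter
      (measurableSet_lt (ham.comp measurable_covZ) measurable_obsY)
  have hv01 : ∀ o, 0 ≤ v o ∧ v o ≤ 1 := fun o => by simp only [hv]; split_ifs <;> norm_num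
  have hvb : ∀ o, |v o| ≤ 1 := fun o => abs_le.2 ⟨by linarith [(hv01 o).1], (hv01 o).2⟩
  have hvi : Integrable v P := integrable_of_bdd hvm hvb
  -- Clipping gives a version of E(v | D, Z) in [0, 1] everywhere, because the bound on w is
  -- required at every point.
  set p : Bool × 𝒵 → ℝ := fun x => max 0 (min 1 (condMean P covDZ v x)) with hp
  have hpm : Measurable p := measurable_const.max (measurable_const.min (measurable_condMean _ _ _))
  have hp01 : ∀ x, 0 ≤ p x ∧ p x ≤ 1 := fun x =>
    ⟨le_max_left _ _, max_le zero_le_one (min_le_left _ _)⟩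
  have hpb : ∀ x, |p x| ≤ 1 := fun x => abs_le.2 ⟨by linarith [(hp01 x).1], (hp01 x).2⟩
  have hpe : ∀ᵐ o ∂P, condMean P covDZ v (covDZ o) = p (covDZ o) := by
    filter_upwards [condMean_nonneg (cov := covDZ) (ae_of_all P fun o => (hv01 o).1),
      condMean_mono (cov := covDZ) hvi (integrable_const 1) (ae_of_all P fun o => (hv01 o).2)]
      with o h1 h2
    rw [condMean_const measurable_covDZ] at h2
    simp only [hp]
    rw [min_eq_right h2, max_eq_right h1]
  have hpi : Integrable (fun o : Obs 𝒵 => p (covDZ o)) P :=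
    integrable_of_bdd (hpm.comp measurable_covDZ) fun o => hpb _
  set w : Obs 𝒵 → ℝ := fun o => 1 / 4 * (v o - p (covDZ o)) with hw
  have hwm : Measurable w := (hvm.sub (hpm.comp measurable_covDZ)).const_mul _
  have hwb : ∀ o, |w o| ≤ 1 / 4 := fun o => by
    have h1 := hv01 o
    have h2 := hp01 (covDZ o)
    refine abs_le.2 ⟨?_, ?_⟩ <;> simp only [hw] <;> linarith [h1.1, h1.2, h2.1, h2.2]
  have hwi : Integrable w P := integrable_of_bdd hwm hwb
  have hw0 : ∀ᵐ o ∂P, condMean P covDZ w (covDZ o) = 0 := by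
    filter_upwards [condMean_const_mul (P := P) (cov := covDZ) (1 / 4)
      (fun o => v o - p (covDZ o)), condMean_sub (cov := covDZ) hvi hpi,
      condMean_comp_cov measurable_covDZ hpm hpi, hpe] with o e1 e2 e3 e4
    rw [e1, e2, e3, e4, sub_self, mul_zero]
  -- the residual
  have haW : Integrable (fun o => a (covZ o) * tiltW δ o) P :=
    integrable_mul_of_condMean measurable_covZ ham hW (ae_of_all _ tiltW_nonneg)
      ((integrable_condMean (cov := covZ) (f := tiltYW δ)).congr (tiltA_mul hpos))
  set f : Obs 𝒵 → ℝ := fun o => tiltYW δ o - a (covZ o) * tiltW δ o with hf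
  have hfe : ∀ o, f o = (obsY o - a (covZ o)) * tiltW δ o := fun o => by
    simp only [hf, tiltYW]
    ring
  have hfi : Integrable f P := hYW.sub haW
  have hf0 : ∀ᵐ o ∂P, condMean P covZ f (covZ o) = 0 := by
    filter_upwards [condMean_sub (cov := covZ) hYW haW, condMean_mul ham hW haW, tiltA_mul hpos]
      with o e1 e2 e3
    rw [e1, e2, e3, sub_self]
  have hD : ∀ o : Obs 𝒵, o.2.1 = true → 0 < tiltW δ o := fun o ho => by
    simp [tiltW, obsD, ho, Real.exp_pos]
  have hD' : ∀ o : Obs 𝒵, o.2.1 = false → tiltW δ o = 0 := fun o ho => by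
    simp [tiltW, obsD, ho]
  set g : Obs 𝒵 → ℝ := fun o => v o * f o with hg
  have hgi : Integrable g P := integrable_bdd_mul hvm hvb hfi
  have hg0 : ∀ o, 0 ≤ g o := fun o => by
    simp only [hg, hv]
    split_ifs with h
    · rw [hfe, one_mul]
      exact mul_nonneg (sub_nonneg.2 h.2.le) (tiltW_nonneg o)
    · simp
  -- the first moment
  set p₁ : 𝒵 → ℝ := fun z => p (true, z) with hp₁
  have hp₁m : Measurable p₁ := hpm.comp (measurable_const.prodMk measurable_id)
  -- W vanishes when D = 0, so against W the centring term depends on Z alone and drops out against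
  -- the residual f, of conditional mean zero.
  have hpW : ∀ o : Obs 𝒵, p (covDZ o) * tiltW δ o = p₁ (covZ o) * tiltW δ o := fun o => by
    cases h : o.2.1
    · rw [hD' o h, mul_zero, mul_zero]
    · have : covDZ o = (true, covZ o) := Prod.ext h rfl
      rw [this]
  have hβ : ∀ᵐ o ∂P, condMean P covZ (fun o => w o * tiltYW δ o) (covZ o)
      - a (covZ o) * condMean P covZ (fun o => w o * tiltW δ o) (covZ o)
      = 1 / 4 * condMean P covZ g (covZ o) := by
    have i1 := integrable_bdd_mul hwm hwb hYW
    have i2 := integrable_bdd_mul hwm hwb hW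
    have i3 : Integrable (fun o => a (covZ o) * (w o * tiltW δ o)) P := by
      refine (integrable_bdd_mul hwm hwb haW).congr (ae_of_all _ fun o => ?_)
      simp only []
      ring
    have i4 : Integrable (fun o => p₁ (covZ o) * f o) P :=
      integrable_bdd_mul (hp₁m.comp measurable_covZ) (fun o => hpb _) hfi
    have e : (fun o => w o * tiltYW δ o - a (covZ o) * (w o * tiltW δ o))
        = fun o => 1 / 4 * (g o - p₁ (covZ o) * f o) := by
      funext o
      simp only [hw, hg, hfe, tiltYW]
      linear_combination (1 / 4) * (a (covZ o) - obsY o) * hpW o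
    have h1 := condMean_sub (cov := covZ) i1 i3
    rw [e] at h1
    filter_upwards [h1, condMean_mul ham i2 i3, condMean_const_mul (P := P) (cov := covZ) (1 / 4)
      (fun o => g o - p₁ (covZ o) * f o), condMean_sub (cov := covZ) hgi i4,
      condMean_mul hp₁m hfi i4, hf0] with o k1 k2 k3 k4 k5 k6
    rw [← k2, ← k1, k3, k4, k5, k6, mul_zero, sub_zero]
  have hnil : ∀ {E : Set 𝒵}, MeasurableSet E → (∀ᵐ o ∂P, covZ o ∈ E → 0 ≤ f o) →
      ∀ᵐ o ∂P, covZ o ∈ E → f o = 0 := fun hE h =>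
    ae_eq_zero_of_condMean_eq_zero measurable_covZ hfi hE h (hf0.mono fun o ho _ => ho)
  have hnil' : ∀ {E : Set 𝒵}, MeasurableSet E → (∀ᵐ o ∂P, covZ o ∈ E → f o ≤ 0) →
      ∀ᵐ o ∂P, covZ o ∈ E → f o = 0 := fun hE h => by
    have h1 := ae_eq_zero_of_condMean_eq_zero (f := fun o => -1 * f o) measurable_covZ
      (hfi.const_mul (-1)) hE (h.mono fun o ho hE => by linarith [ho hE]) (by
        filter_upwards [condMean_const_mul (P := P) (cov := covZ) (-1) f, hf0] with o h1 h2 _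
        rw [h1, h2, mul_zero])
    exact h1.mono fun o ho hE => by linarith [ho hE]
  have hfD : ∀ o : Obs 𝒵, (o.2.1 = true → 0 ≤ obsY o - a (covZ o)) → 0 ≤ f o := fun o h => by
    rw [hfe]
    cases ho : o.2.1
    · rw [hD' o ho, mul_zero]
    · exact mul_nonneg (h ho) (tiltW_nonneg o)
  have hfD' : ∀ o : Obs 𝒵, (o.2.1 = true → obsY o - a (covZ o) ≤ 0) → f o ≤ 0 := fun o h => by
    rw [hfe]
    cases ho : o.2.1
    · rw [hD' o ho, mul_zero]
    · exact mul_nonpos_of_nonpos_of_nonneg (h ho) (tiltW_nonneg o)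
  -- The positive part g of f vanishes on this set of Z, so f ≤ 0 there, and its zero conditional
  -- mean forces f = 0.
  have case1 : ∀ᵐ o ∂P, condMean P covZ g (covZ o) = 0 → f o = 0 := by
    have hE : MeasurableSet {z | condMean P covZ g z = 0} :=
      measurable_condMean P covZ g (measurableSet_singleton 0)
    have h1 := ae_eq_zero_of_condMean_eq_zero measurable_covZ hgi hE
      (ae_of_all P fun o _ => hg0 o) (ae_of_all P fun o ho => ho)
    refine hnil' hE (h1.mono fun o ho hoE => hfD' o fun hDo => ?_)
    by_contra hlt
    have hlt' : a (covZ o) < obsY o := by linarith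
    have h2 := ho hoE
    simp only [hg, hv, hDo, hlt', and_self, if_true, one_mul, hfe] at h2
    exact absurd h2 (mul_pos (by linarith) (hD o hDo)).ne'
  -- the second moment
  have case2 : ∀ᵐ o ∂P, condMean P covZ (fun o => w o * tiltW δ o) (covZ o) = 0 → f o = 0 := by
    set E : Set 𝒵 := {z | condMean P covZ (fun o => w o * tiltW δ o) z = 0} with hEdef
    have hE : MeasurableSet E := measurable_condMean P covZ _ (measurableSet_singleton 0)
    -- The aim is to replace exp(δY) by exp(δY) - exp(δa), which costs nothing as w is centred given
    -- (D, Z). This weight carries the sign of δ and keeps both ω and ω exp(δa) bounded by |δ|,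
    -- hence all terms integrable.
    set ω : 𝒵 → ℝ := fun z => δ * (1 + Real.exp (δ * a z))⁻¹ with hω
    have hωm : Measurable ω := ((ham.const_mul δ).exp.const_add 1).inv.const_mul δ
    have hωe : ∀ z, 0 < (1 + Real.exp (δ * a z))⁻¹ := fun z => by positivity
    have hωb : ∀ z, |ω z| ≤ |δ| := fun z => by
      simp only [hω]
      rw [abs_mul, abs_of_pos (hωe z)]
      refine mul_le_of_le_one_right (abs_nonneg _) (inv_le_one_of_one_le₀ ?_)
      linarith [Real.exp_pos (δ * a z)]
    set κ : Bool × 𝒵 → ℝ := fun x => ω x.2 * Real.exp (δ * a x.2) * (if x.1 then 1 else 0) with hκ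
    have hκm : Measurable κ := ((hωm.comp measurable_snd).mul
      ((ham.comp measurable_snd).const_mul δ).exp).mul (Measurable.ite
        (measurable_fst (measurableSet_singleton true)) measurable_const measurable_const)
    have hκb : ∀ x, |κ x| ≤ |δ| := fun x => by
      have h1 : |(if x.1 then (1 : ℝ) else 0)| ≤ 1 := by split_ifs <;> simp
      have h2 : |ω x.2 * Real.exp (δ * a x.2)| ≤ |δ| := by
        simp only [hω]
        rw [mul_assoc, abs_mul]
        refine mul_le_of_le_one_right (abs_nonneg _) ?_
        rw [abs_of_pos (mul_pos (hωe _) (Real.exp_pos _)), inv_mul_le_iff₀ (by positivity)]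
        linarith
      simp only [hκ]
      rw [abs_mul]
      exact (mul_le_of_le_one_right (abs_nonneg _) h1).trans h2
    have i1 := integrable_bdd_mul hwm hwb hW
    have i2 : Integrable (fun o => ω (covZ o) * (w o * tiltW δ o)) P :=
      integrable_bdd_mul (hωm.comp measurable_covZ) (fun o => hωb _) i1
    have i3 : Integrable (fun o => κ (covDZ o) * w o) P :=
      integrable_bdd_mul (hκm.comp measurable_covDZ) (fun o => hκb _) hwi
    have hκ0 : ∀ᵐ o ∂P, condMean P covZ (fun o => κ (covDZ o) * w o) (covZ o) = 0 := by
      refine condMean_covZ_eq_zero i3 ?_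
      filter_upwards [condMean_mul hκm hwi i3, hw0] with o e1 e2
      rw [e1, e2, mul_zero]
    have hform : ∀ o, ω (covZ o) * (w o * tiltW δ o) - κ (covDZ o) * w o
        = (1 + Real.exp (δ * a (covZ o)))⁻¹ * obsD o
          * (δ * (Real.exp (δ * obsY o) - Real.exp (δ * a (covZ o)))) * w o := fun o => by
      simp only [hω, hκ, tiltW, obsD, covZ, covDZ]
      ring
    have hsign : ∀ y b : ℝ, (b < y → 0 < δ * (Real.exp (δ * y) - Real.exp (δ * b))) ∧
        (y < b → δ * (Real.exp (δ * y) - Real.exp (δ * b)) < 0) := by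
      have key : ∀ y b : ℝ, b < y → 0 < δ * (Real.exp (δ * y) - Real.exp (δ * b)) := by
        intro y b hyb
        rcases hδ.lt_or_gt with h | h
        · refine mul_pos_of_neg_of_neg h (sub_neg.2 (Real.exp_lt_exp.2 ?_))
          exact mul_lt_mul_of_neg_left hyb h
        · refine mul_pos h (sub_pos.2 (Real.exp_lt_exp.2 ?_))
          exact mul_lt_mul_of_pos_left hyb h
      exact fun y b => ⟨key y b, fun h => by linarith [key b y h]⟩
    have hDp : ∀ o : Obs 𝒵, o.2.1 = true → obsD o = 1 ∧ p (covDZ o) = p₁ (covZ o) ∧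
        (a (covZ o) < obsY o → v o = 1) ∧ (obsY o ≤ a (covZ o) → v o = 0) := fun o ho => by
      refine ⟨by simp [obsD, ho], ?_, fun h => by simp [hv, ho, h], fun h => by
        simp [hv, ho, not_lt.2 h]⟩
      have : covDZ o = (true, covZ o) := Prod.ext ho rfl
      rw [this]
    -- When D = 1, w ≥ 0 if Y > a and w ≤ 0 if Y < a, matching the sign of δ{exp(δY) - exp(δa)}.
    have hnonneg : ∀ o, 0 ≤ ω (covZ o) * (w o * tiltW δ o) - κ (covDZ o) * w o := fun o => by
      rw [hform]
      cases ho : o.2.1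
      · simp [obsD, ho]
      · obtain ⟨h1, -, h3, h4⟩ := hDp o ho
        rw [h1, mul_one, mul_assoc]
        refine mul_nonneg (hωe _).le ?_
        rcases lt_trichotomy (obsY o) (a (covZ o)) with h | h | h
        · refine mul_nonneg_of_nonpos_of_nonpos ((hsign _ _).2 h).le ?_
          simp only [hw]
          rw [h4 h.le]
          linarith [(hp01 (covDZ o)).1]
        · rw [h]
          simp
        · refine mul_nonneg ((hsign _ _).1 h).le ?_
          simp only [hw]
          rw [h3 h]
          linarith [(hp01 (covDZ o)).2]
    have hz := ae_eq_zero_of_condMean_eq_zero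
      (f := fun o => ω (covZ o) * (w o * tiltW δ o) - κ (covDZ o) * w o) measurable_covZ
      (i2.sub i3) hE (ae_of_all P fun o _ => hnonneg o) (by
        filter_upwards [condMean_sub (cov := covZ) i2 i3, condMean_mul hωm i1 i2, hκ0]
          with o e1 e2 e3 ho
        have ho' : condMean P covZ (fun o => w o * tiltW δ o) (covZ o) = 0 := ho
        rw [e1, e2, e3, ho', mul_zero, sub_zero])
    have hz' : ∀ᵐ o ∂P, covZ o ∈ E → o.2.1 = true →
        obsY o = a (covZ o) ∨ v o = p₁ (covZ o) := by
      filter_upwards [hz] with o ho hoE hDo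
      obtain ⟨h1, h2, -, -⟩ := hDp o hDo
      have h5 := ho hoE
      rw [hform, h1, mul_one, mul_assoc] at h5
      rcases mul_eq_zero.1 ((mul_eq_zero.1 h5).resolve_left (hωe _).ne') with h6 | h6
      · left
        rcases lt_trichotomy (obsY o) (a (covZ o)) with h | h | h
        · exact absurd h6 ((hsign _ _).2 h).ne
        · exact h
        · exact absurd h6 ((hsign _ _).1 h).ne'
      · right
        simp only [hw, h2] at h6
        linarith
    -- When D = 1, either Y = a or v = p₁(Z). As v is 0 or 1, p₁ = 1 gives Y ≥ a and p₁ ≠ 1 gives Y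
    -- ≤ a; in both cases f has one sign and vanishes.
    have hF : MeasurableSet {z | p₁ z = 1} := hp₁m (measurableSet_singleton 1)
    have hin := hnil (hE.inter hF) (hz'.mono fun o ho hoE => hfD o fun hDo => by
      rcases ho hoE.1 hDo with h | h
      · rw [h, sub_self]
      · by_contra hlt
        have h7 := (hDp o hDo).2.2.2 (by linarith)
        have h8 : p₁ (covZ o) = 1 := hoE.2
        linarith)
    have hout := hnil' (hE.inter hF.compl) (hz'.mono fun o ho hoE => hfD' o fun hDo => by
      rcases ho hoE.1 hDo with h | h
      · rw [h, sub_self]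
      · by_contra hlt
        have h7 := (hDp o hDo).2.2.1 (by linarith)
        exact hoE.2 (h.symm.trans h7))
    filter_upwards [hin, hout] with o h1 h2 ho
    by_cases h : p₁ (covZ o) = 1
    · exact h1 ⟨ho, h⟩
    · exact h2 ⟨ho, h⟩
  refine ⟨w, hwm, hwb, hw0, ?_, ?_⟩
  · filter_upwards [hβ, condMean_nonneg (cov := covZ) (ae_of_all P hg0)] with o h1 h2
    rw [h1]
    positivity
  · filter_upwards [hβ, case1, case2] with o h1 h2 h3 h4 hDo
    have h5 : f o = 0 := by
      rcases h4 with h4 | h4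
      · rw [h1] at h4
        exact h2 (by linarith)
      · exact h3 h4
    rw [hfe] at h5
    linarith [(mul_eq_zero.1 h5).resolve_right (hD o hDo).ne']

/-- `ψ` is in the Chernozhukov–Newey class neither for `Z` nor for `(D, Z)`. -/
theorem MNARConditions.psi_notMem_cnClass (hreg : MNARConditions δ M) (hδ : δ ≠ 0)
    (hM : IsNonparametric M) (hnd : OutcomeNondegenerate M) :
    psi δ ∉ cnClass M covZ ∧ psi δ ∉ cnClass M covDZ := by
  obtain ⟨P, hP, hf⟩ := hnd
  have := hM.prob P hP
  obtain ⟨w, hw, hb, h0, hβ, hfin⟩ := hreg.exists_score hδ hM hP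
  have key : ¬ (psi δ (reweight P (linearDensity w 2)) - 3 * psi δ (reweight P (linearDensity w 1))
      + 3 * psi δ (reweight P (linearDensity w 0))
      - psi δ (reweight P (linearDensity w (-1))) = 0) := by
    intro h3
    -- Nondegeneracy is contradicted by a(Z) itself as the function of Z.
    refine hf (tiltA δ P) measurable_tiltA ?_
    have h4 : ∀ᵐ o ∂P, ¬ (o.2.1 = true ∧ 0 < condMean P covZ (fun o => 1 - obsD o) (covZ o) ∧
        obsY o ≠ tiltA δ P (covZ o)) := by
      filter_upwards [hreg.moment_eq_zero_of_third_difference hM hP hw hb h0 hβ h3, hfin]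
        with o h1 h2 h
      exact h.2.2 (h2 (h1 h.2.1) h.1)
    rw [ae_iff] at h4
    simpa only [not_not] using h4
  exact ⟨fun h => key (third_difference_eq_zero hM measurable_covZ h hP hw hb
      (condMean_covZ_eq_zero (integrable_of_bdd hw hb) h0)),
    fun h => key (third_difference_eq_zero hM measurable_covDZ h hP hw hb h0)⟩

/-- The Chernozhukov–Newey class is stable under subtracting the mean of a statistic. -/
theorem sub_integral_mem_cnClass {Ω : Type u} [MeasurableSpace Ω] {W : Type v} [MeasurableSpace W]
    {M : Set (Measure Ω)} {cov : Ω → W} {θ θ' : Measure Ω → ℝ} {f : Ω → ℝ} (hf : Measurable f)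
    (hfi : ∀ P ∈ M, Integrable f P) (h : ∀ P ∈ M, θ P = ∫ o, f o ∂P + θ' P)
    (hθ : θ ∈ cnClass M cov) : θ' ∈ cnClass M cov := by
  obtain ⟨m, q, S₀, H⟩ := hθ
  refine ⟨m, q, fun o => S₀ o - f o, ⟨H.measurable_q, H.measurable_S₀.sub hf, H.integrable_q,
    fun P hP => (H.integrable_S₀ P hP).sub (hfi P hP), H.memLp_a, H.integrable_m,
    H.continuous_linear, fun P hP => ?_⟩⟩
  rw [integral_sub (H.integrable_S₀ P hP) (hfi P hP)]
  linarith [h P hP, H.eq P hP]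

theorem regularCNClass_subset_cnClass {Ω : Type u} [MeasurableSpace Ω] {W : Type v}
    [MeasurableSpace W] {M : Set (Measure Ω)} {cov : Ω → W} :
    regularCNClass M cov ⊆ cnClass M cov := by
  rintro θ ⟨-, m, q, S₀, -, H, -, -⟩
  exact ⟨m, q, S₀, H⟩

end NonMembership

end MixedBias

/-! ### The assembled claims. -/

theorem mainTheorem6 {𝒵 : Type*} [MeasurableSpace 𝒵] (δ : ℝ) (hδ : δ ≠ 0)
    (M : Set (Measure (MixedBias.Obs 𝒵))) (hM : MixedBias.IsNonparametric M)
    (hreg : MixedBias.MNARConditions δ M) (hnd : MixedBias.OutcomeNondegenerate M) :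
    MixedBias.MixedBiasWith M MixedBias.covZ (MixedBias.psi δ) (fun o => -MixedBias.tiltW δ o)
      (MixedBias.tiltA δ) (MixedBias.tiltB δ) ∧
    MixedBias.psi δ ∉ MixedBias.cnClass M MixedBias.covZ ∧
    MixedBias.psi δ ∉ MixedBias.cnClass M MixedBias.covDZ ∧
    ((∀ P ∈ M, MemLp MixedBias.obsY 2 P) →
      MixedBias.MixedBiasWith M MixedBias.covZ (MixedBias.meanMNAR δ)
        (fun o => -MixedBias.tiltW δ o) (MixedBias.tiltA δ) (MixedBias.tiltB δ) ∧
      MixedBias.meanMNAR δ ∉ MixedBias.cnClass M MixedBias.covZ ∧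
      MixedBias.meanMNAR δ ∉ MixedBias.cnClass M MixedBias.covDZ) ∧
    MixedBias.regularCNClass M MixedBias.covZ ∪ MixedBias.regularCNClass M MixedBias.covDZ ⊂
      MixedBias.mixedBiasClass M MixedBias.covZ ∪ MixedBias.mixedBiasClass M MixedBias.covDZ := by
  obtain ⟨hZ, hDZ⟩ := hreg.psi_notMem_cnClass hδ hM hnd
  have hψ := hreg.mixedBiasWith_psi hM
  refine ⟨hψ, hZ, hDZ, fun hY => ?_, ?_⟩
  · have hYi : ∀ P ∈ M, Integrable MixedBias.obsY P := fun P hP => by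
      have := hM.prob P hP
      exact (hY P hP).integrable one_le_two
    have heq : ∀ P ∈ M, MixedBias.meanMNAR δ P
        = ∫ o, MixedBias.obsY o ∂P + MixedBias.psi δ P := fun P hP =>
      hreg.meanMNAR_eq hM hP (hYi P hP)
    exact ⟨hreg.mixedBiasWith_meanMNAR hM hY,
      fun h => hZ (MixedBias.sub_integral_mem_cnClass MixedBias.measurable_obsY hYi heq h),
      fun h => hDZ (MixedBias.sub_integral_mem_cnClass MixedBias.measurable_obsY hYi heq h)⟩
  · refine ⟨Set.union_subset_union
      (MixedBias.regularCNClass_subset_mixedBiasClass hM MixedBias.measurable_covZ)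
      (MixedBias.regularCNClass_subset_mixedBiasClass hM MixedBias.measurable_covDZ), fun h => ?_⟩
    -- Strictness: the reverse inclusion would put ψ, which has the mixed bias property for Z, in
    -- one of the two excluded classes.
    rcases h (Or.inl ⟨_, _, _, hψ⟩ : MixedBias.psi δ ∈ _) with h | h
    · exact hZ (MixedBias.regularCNClass_subset_cnClass h)
    · exact hDZ (MixedBias.regularCNClass_subset_cnClass h)
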